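/- Fix $\alpha\in(0,1)$. For $j=0,1,2$ let $C^{j,\alpha}(\mathbb R)$ be the space of $C^j$ functions $u:\mathbb R\to\mathbb R$ with $u,\dots,u^{(j)}$ bounded and $u^{(j)}$ globally $\alpha$-Hölder continuous, with the norm $\sum_{i\le j}\sup|u^{(i)}|+[u^{(j)}]_\alpha$, and let $C^{j,\alpha}_{p,e}(\mathbb R)$ be its subspace of even, $2\pi$-periodic functions. For $\phi\in C^{2,\alpha}(\mathbb R)$ with $\inf\phi>0$ let $Z_\phi=\{(\phi(s)\sigma,s):s\in\mathbb R,\ \sigma\in S^1\}\subset\mathbb R^2\times\mathbb R$ with surface measure $d\sigma$, let $\nu^+$ be its unit normal pointing into $\{(z,t):|z|>\phi(t)\}$, and put, with $x=(\phi(s)e_1,s)$, $e_1=(1,0)$, $$H(\phi)(s)=\int_{Z_\phi}\frac{(y-x)\cdot\nu^+(x)}{|x-y|^3}\,d\sigma(y),\qquad \mathcal H(\phi)(s)=-\sqrt{1+\phi'(s)^2}\,H(\phi)(s).$$ For $s,t,\xi,p\in\mathbb R$ set $\Lambda_0(\phi,s,t)=\int_0^1\phi'(s-\rho t)\,d\rho$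 (which is $\frac{\phi(s)-\phi(s-t)}{t}$ for $t\neq0$), $\Lambda_1(\phi,s,t)=\Lambda_0(\phi,s,t)-\phi'(s)$, $$\mathcal K(\phi,s,t,\xi)=\frac{\phi(s-\xi)\sqrt{1+\phi'(s-\xi)^2}}{\{t^2+t^2\Lambda_0(\phi,s,\xi)^2+\phi(s)\phi(s-\xi)\}^{3/2}},$$ $$\mathcal M(\phi,s,t,p)=t\,\Lambda_1(\phi,s,tp)\,\mathcal K(\phi,s,t,tp),\qquad \overline{\mathcal M}(\phi,s,t,p)=\phi(s-tp)\,\mathcal K(\phi,s,t,tp),$$ and $p_\sigma=|\sigma-e_1|$ for $\sigma\in S^1$. Let $\delta>0$, $\mathcal O_\delta=\{\phi\in C^{2,\alpha}_{p,e}(\mathbb R):\min\phi>\delta\}$ and $\mathcal V_\delta=\{\phi\in C^{2,\alpha}(\mathbb R):\inf\phi>\delta\}$. These sets are open in $C^{2,\alpha}_{p,e}(\mathbb R)$ and $C^{2,\alpha}(\mathbb R)$, respectively. For $\phi\in\mathcal V_\delta$ the integral $H(\phi)(s)$ converges absolutely for every $s$, and $\mathcal H(\phi)\in C^{1,\alpha}(\mathbb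 R)$. The map $\mathcal H:\mathcal O_\delta\to C^{1,\alpha}(\mathbb R)$ is of class $C^\infty$; for all $s,t,p\in\mathbb R$ so are $\phi\mapsto\mathcal M(\phi,s,t,p)$ and $\phi\mapsto\overline{\mathcal M}(\phi,s,t,p)$ on $\mathcal O_\delta$; and for every integer $k\ge0$, $\phi\in\mathcal O_\delta$, $v_1,\dots,v_k\in C^{2,\alpha}_{p,e}(\mathbb R)$ and $s\in\mathbb R$, $$D^k\mathcal H(\phi)[v_1,\dots,v_k](s)=\int_{S^1}\frac1{p_\sigma}\int_{\mathbb R}D^k_\phi\mathcal M(\phi,s,t,p_\sigma)[v_1,\dots,v_k]\,dt\,d\sigma+\frac12\int_{S^1}\int_{\mathbb R}D^k_\phi\overline{\mathcal M}(\phi,s,t,p_\sigma)[v_1,\dots,v_k]\,dt\,d\sigma,$$ where both integrals converge absolutely on $S^1\times\mathbb R$. Moreover, the same three assertions (smoothness of $\mathcal H$, smoothness of $\mathcal M$ and $\overline{\mathcal M}$, and the derivative formula with absolute convergence) hold for the map $\mathcal H:\mathcal V_\delta\to C^{1,\alpha}(\mathbb R)$, for all $\phi\in\mathcal V_\delta$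 and all $v_1,\dots,v_k\in C^{2,\alpha}(\mathbb R)$. -/

import Mathlib

open MeasureTheory Set
open scoped NNReal ContDiff

namespace ExceptionalDomain

noncomputable section

/-! ### Hölder spaces on the real line -/

/-- The linear space `C^{j,α}(ℝ)`: functions `u : ℝ → ℝ` of class `C^j` such that
`u, u', …, u^{(j)}` are bounded and `u^{(j)}` is (globally) `α`-Hölder continuous. -/
def holderSubmodule (j : ℕ) (α : ℝ≥0) : Submodule ℝ (ℝ → ℝ) where
  carrier := {u | ContDiff ℝ j u ∧
    (∀ i ≤ j, BddAbove (range fun x => |iteratedDeriv i u x|)) ∧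
    MemHolder α (iteratedDeriv j u)}
  zero_mem' := by
    have h : ∀ i : ℕ, iteratedDeriv i (0 : ℝ → ℝ) = 0 := by
      intro i
      ext x
      simp
    refine ⟨contDiff_const, fun i _ => ⟨0, ?_⟩, ?_⟩
    · rintro _ ⟨x, rfl⟩
      simp
    · rw [h j]
      exact memHolder_zero
  add_mem' := by
    rintro u v ⟨hu, hu', hu''⟩ ⟨hv, hv', hv''⟩
    have h : ∀ i ≤ j, iteratedDeriv i (u + v) = iteratedDeriv i u + iteratedDeriv i v := by
      intro i hi
      ext x
      have hi' : (i : WithTop ℕ∞) ≤ j := by exact_mod_cast hi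
      exact iteratedDeriv_add (hu.of_le hi').contDiffAt (hv.of_le hi').contDiffAt
    refine ⟨hu.add hv, fun i hi => ?_, ?_⟩
    · obtain ⟨a, ha⟩ := hu' i hi
      obtain ⟨b, hb⟩ := hv' i hi
      refine ⟨a + b, ?_⟩
      rintro _ ⟨x, rfl⟩
      simp only [h i hi, Pi.add_apply]
      exact (abs_add_le _ _).trans (add_le_add (ha ⟨x, rfl⟩) (hb ⟨x, rfl⟩))
    · rw [h j le_rfl]
      exact hu''.add hv''
  smul_mem' := by
    rintro c u ⟨hu, hu', hu''⟩
    have h : ∀ i ≤ j, iteratedDeriv i (c • u) = c • iteratedDeriv i u := by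
      intro i hi
      ext x
      have hi' : (i : WithTop ℕ∞) ≤ j := by exact_mod_cast hi
      exact iteratedDeriv_const_smul (hu.of_le hi').contDiffAt c
    refine ⟨hu.const_smul c, fun i hi => ?_, ?_⟩
    · obtain ⟨a, ha⟩ := hu' i hi
      refine ⟨|c| * a, ?_⟩
      rintro _ ⟨x, rfl⟩
      simp only [h i hi, Pi.smul_apply, smul_eq_mul, abs_mul]
      exact mul_le_mul_of_nonneg_left (ha ⟨x, rfl⟩) (abs_nonneg c)
    · rw [h j le_rfl]
      exact hu''.smul

/-- The space `C^{j,α}(ℝ)`. -/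
def HolderSpace (j : ℕ) (α : ℝ≥0) : Type := holderSubmodule j α

namespace HolderSpace

variable {j : ℕ} {α : ℝ≥0}

instance : AddCommGroup (HolderSpace j α) := inferInstanceAs (AddCommGroup (holderSubmodule j α))

instance : Module ℝ (HolderSpace j α) := inferInstanceAs (Module ℝ (holderSubmodule j α))

instance : CoeFun (HolderSpace j α) fun _ => ℝ → ℝ := ⟨fun u => u.1⟩

/-- The norm `‖u‖ = ∑_{i ≤ j} sup |u^{(i)}| + [u^{(j)}]_α`. -/
instance : Norm (HolderSpace j α) :=
  ⟨fun u => (∑ i ∈ Finset.range (j + 1), ⨆ x, |iteratedDeriv i u x|) +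
    (nnHolderNorm α (iteratedDeriv j u) : ℝ)⟩

theorem norm_def (u : HolderSpace j α) :
    ‖u‖ = (∑ i ∈ Finset.range (j + 1), ⨆ x, |iteratedDeriv i u x|) +
      (nnHolderNorm α (iteratedDeriv j u) : ℝ) := rfl

theorem iteratedDeriv_coe_add (u v : HolderSpace j α) {i : ℕ} (hi : i ≤ j) :
    iteratedDeriv i (u + v : HolderSpace j α) = iteratedDeriv i u + iteratedDeriv i v := by
  ext x
  have hi' : (i : WithTop ℕ∞) ≤ j := by exact_mod_cast hi
  exact iteratedDeriv_add (u.2.1.of_le hi').contDiffAt (v.2.1.of_le hi').contDiffAt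

theorem iteratedDeriv_coe_smul (c : ℝ) (u : HolderSpace j α) {i : ℕ} (hi : i ≤ j) :
    iteratedDeriv i (c • u : HolderSpace j α) = c • iteratedDeriv i u := by
  ext x
  have hi' : (i : WithTop ℕ∞) ≤ j := by exact_mod_cast hi
  exact iteratedDeriv_const_smul (u.2.1.of_le hi').contDiffAt c

theorem normCore (j : ℕ) (α : ℝ≥0) : NormedSpace.Core ℝ (HolderSpace j α) where
  norm_nonneg u := by
    rw [norm_def]
    exact add_nonneg (Finset.sum_nonneg fun i _ => Real.iSup_nonneg fun x => abs_nonneg _)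
      (NNReal.coe_nonneg _)
  norm_smul c u := by
    rw [norm_def, norm_def, mul_add, Finset.mul_sum]
    congr 1
    · refine Finset.sum_congr rfl fun i hi => ?_
      rw [iteratedDeriv_coe_smul c u (Nat.lt_succ_iff.mp (Finset.mem_range.mp hi)),
        Real.mul_iSup_of_nonneg (norm_nonneg c)]
      simp [abs_mul]
    · rw [iteratedDeriv_coe_smul c u le_rfl, u.2.2.2.nnHolderNorm_smul]
      simp
  norm_triangle u v := by
    rw [norm_def, norm_def, norm_def, add_add_add_comm, ← Finset.sum_add_distrib]
    refine add_le_add (Finset.sum_le_sum fun i hi => ?_) ?_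
    · have hi' := Nat.lt_succ_iff.mp (Finset.mem_range.mp hi)
      rw [iteratedDeriv_coe_add u v hi']
      refine ciSup_le fun x => (abs_add_le _ _).trans (add_le_add ?_ ?_)
      · exact le_ciSup (u.2.2.1 i hi') x
      · exact le_ciSup (v.2.2.1 i hi') x
    · rw [iteratedDeriv_coe_add u v le_rfl]
      exact_mod_cast u.2.2.2.nnHolderNorm_add_le v.2.2.2
  norm_eq_zero_iff u := by
    constructor
    · intro h
      rw [norm_def] at h
      have h1 : ∀ i ∈ Finset.range (j + 1), 0 ≤ ⨆ x, |iteratedDeriv i u x| :=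
        fun i _ => Real.iSup_nonneg fun x => abs_nonneg _
      have h2 := (add_eq_zero_iff_of_nonneg (Finset.sum_nonneg h1) (NNReal.coe_nonneg _)).mp h
      have h3 := (Finset.sum_eq_zero_iff_of_nonneg h1).mp h2.1 0 (by simp)
      apply Subtype.ext
      ext x
      have h4 := le_ciSup (u.2.2.1 0 (Nat.zero_le _)) x
      rw [h3] at h4
      simp only [iteratedDeriv_zero] at h4
      exact abs_nonpos_iff.mp h4
    · rintro rfl
      have h : ∀ i : ℕ, iteratedDeriv i ((0 : HolderSpace j α) : ℝ → ℝ) = 0 := by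
        intro i
        ext x
        change iteratedDeriv i (0 : ℝ → ℝ) x = 0
        simp
      rw [norm_def]
      simp [h]

instance : NormedAddCommGroup (HolderSpace j α) := NormedAddCommGroup.ofCore (normCore j α)

instance : NormedSpace ℝ (HolderSpace j α) := NormedSpace.ofCore (normCore j α)

end HolderSpace

/-- The subspace `C^{j,α}_{p,e}(ℝ)` of even and `2π`-periodic functions in `C^{j,α}(ℝ)`. -/
def evenPeriodic (j : ℕ) (α : ℝ≥0) : Submodule ℝ (HolderSpace j α) where
  carrier := {u | Function.Even u ∧ Function.Periodic u (2 * Real.pi)}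
  zero_mem' := ⟨fun _ => rfl, fun _ => rfl⟩
  add_mem' := fun hu hv =>
    ⟨fun x => congrArg₂ (· + ·) (hu.1 x) (hv.1 x), fun x => congrArg₂ (· + ·) (hu.2 x) (hv.2 x)⟩
  smul_mem' := fun c _ hu =>
    ⟨fun x => congrArg (c * ·) (hu.1 x), fun x => congrArg (c * ·) (hu.2 x)⟩

/-- The set of all `φ ∈ C^{2,α}(ℝ)` with `inf φ > δ`. -/
def aboveSet (α : ℝ≥0) (δ : ℝ) : Set (HolderSpace 2 α) := {φ | δ < ⨅ s, φ s}

/-- The set `𝒪_δ` of all `φ ∈ C^{2,α}_{p,e}(ℝ)` with `min φ > δ`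
(by periodicity, the infimum is a minimum). -/
def aboveSetEvenPeriodic (α : ℝ≥0) (δ : ℝ) : Set (evenPeriodic 2 α) :=
  {φ | δ < ⨅ s, (φ : HolderSpace 2 α) s}

/-! ### The surface of revolution `Z_φ` and the operator `H` -/

/-- The parametrization `(s, σ) ↦ (φ(s) σ, s)` of `Z_φ ⊆ ℝ² × ℝ = ℝ³`, `σ = (cos θ, sin θ)`. -/
def surfaceMap (φ : ℝ → ℝ) (s θ : ℝ) : EuclideanSpace ℝ (Fin 3) :=
  !₂[φ s * Real.cos θ, φ s * Real.sin θ, s]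

/-- The area element `√(|F_s|² |F_θ|² - (F_s · F_θ)²)` of the parametrization `F` of `Z_φ`. -/
def areaElement (φ : ℝ → ℝ) (s θ : ℝ) : ℝ :=
  √(‖deriv (fun r => surfaceMap φ r θ) s‖ ^ 2 * ‖deriv (fun τ => surfaceMap φ s τ) θ‖ ^ 2 -
    inner ℝ (deriv (fun r => surfaceMap φ r θ) s) (deriv (fun τ => surfaceMap φ s τ) θ) ^ 2)

/-- The surface measure `dσ` of `Z_φ`, as a measure on `ℝ³` carried by `Z_φ`. -/
def surfaceMeasure (φ : ℝ → ℝ) : Measure (EuclideanSpace ℝ (Fin 3)) :=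
  (((volume : Measure (ℝ × ℝ)).restrict (univ ×ˢ Ioc (-Real.pi) Real.pi)).withDensity
    fun q => ENNReal.ofReal (areaElement φ q.1 q.2)).map fun q => surfaceMap φ q.1 q.2

/-- The unit normal `ν⁺` on `Z_φ` pointing into `{(z, t) : |z| > φ(t)}`, at the point
`(φ(s) σ, s)`, `σ = (cos θ, sin θ)`. -/
def unitNormal (φ : ℝ → ℝ) (s θ : ℝ) : EuclideanSpace ℝ (Fin 3) :=
  (1 / √(1 + deriv φ s ^ 2)) • !₂[Real.cos θ, Real.sin θ, -deriv φ s]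

/-- The integrand `y ↦ (y - x) · ν⁺(x) / |x - y|³` at the point `x = (φ(s) e₁, s)` of `Z_φ`. -/
def fieldIntegrand (φ : ℝ → ℝ) (s : ℝ) (y : EuclideanSpace ℝ (Fin 3)) : ℝ :=
  inner ℝ (y - surfaceMap φ s 0) (unitNormal φ s 0) / ‖surfaceMap φ s 0 - y‖ ^ 3

/-- `H(φ)(s) = ∫_{Z_φ} (y - x) · ν⁺(x) / |x - y|³ dσ(y)` with `x = (φ(s) e₁, s)`. -/
def opH (φ : ℝ → ℝ) (s : ℝ) : ℝ := ∫ y, fieldIntegrand φ s y ∂(surfaceMeasure φ)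

/-- `𝓗(φ)(s) = -√(1 + φ'(s)²) H(φ)(s)`. -/
def calH (φ : ℝ → ℝ) (s : ℝ) : ℝ := -√(1 + deriv φ s ^ 2) * opH φ s

/-! ### The kernels -/

/-- `p_σ = |σ - e₁|` for `σ = (cos θ, sin θ) ∈ S¹`. -/
def chord (θ : ℝ) : ℝ :=
  ‖(!₂[Real.cos θ, Real.sin θ] : EuclideanSpace ℝ (Fin 2)) - !₂[1, 0]‖

/-- `Λ₀(φ, s, t) = ∫₀¹ φ'(s - ρ t) dρ`, which is `(φ(s) - φ(s - t)) / t` if `t ≠ 0`. -/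
def lambda0 (φ : ℝ → ℝ) (s t : ℝ) : ℝ := ∫ ρ in (0 : ℝ)..1, deriv φ (s - ρ * t)

/-- `Λ₁(φ, s, t) = Λ₀(φ, s, t) - φ'(s)`. -/
def lambda1 (φ : ℝ → ℝ) (s t : ℝ) : ℝ := lambda0 φ s t - deriv φ s

/-- `𝒦(φ, s, t, ξ)`. -/
def kernelK (φ : ℝ → ℝ) (s t ξ : ℝ) : ℝ :=
  φ (s - ξ) * √(1 + deriv φ (s - ξ) ^ 2) /
    (t ^ 2 + t ^ 2 * lambda0 φ s ξ ^ 2 + φ s * φ (s - ξ)) ^ (3 / 2 : ℝ)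

/-- `ℳ(φ, s, t, p) = t Λ₁(φ, s, tp) 𝒦(φ, s, t, tp)`. -/
def kernelM (φ : ℝ → ℝ) (s t p : ℝ) : ℝ := t * lambda1 φ s (t * p) * kernelK φ s t (t * p)

/-- `ℳ̄(φ, s, t, p) = φ(s - tp) 𝒦(φ, s, t, tp)`. -/
def kernelMbar (φ : ℝ → ℝ) (s t p : ℝ) : ℝ := φ (s - t * p) * kernelK φ s t (t * p)

/-- `∫_{S¹} ∫_ℝ f(σ, t) dt dσ`, with `σ = (cos θ, sin θ)` and `dσ = dθ` on `(-π, π]`. -/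
def circleLineIntegral (f : ℝ → ℝ → ℝ) : ℝ := ∫ θ in Ioc (-Real.pi) Real.pi, ∫ t, f θ t

/-- Absolute convergence of `∫_{S¹} ∫_ℝ f(σ, t) dt dσ`. -/
def CircleLineIntegrable (f : ℝ → ℝ → ℝ) : Prop :=
  Integrable (Function.uncurry f)
    ((volume.restrict (Ioc (-Real.pi) Real.pi)).prod (volume : Measure ℝ))

end

end ExceptionalDomain

/-!
The idea is to write `𝓗` as a composition of bounded linear and bilinear maps with the reciprocal
and the square root of a commutative normed algebra, so that smoothness, and the formula for all the
derivatives at once, follow from the chain rule; no higher derivative is ever estimated.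

*The algebra.* With `ξ = t p` and `τ = |t|`, the kernel `(1 + t²)^{3/2} 𝒦(φ, s, t, t p)` is a
function of `((s, ξ), τ)` obtained from `φ(s)`, `φ(s - ξ)`, `φ'(s - ξ)` and `Λ₀(φ, s, ξ)`, all of
them linear in `φ`, by products, reciprocals and square roots. These functions lie in
`KernelAlgebra α`, the bounded continuous functions that are `α`-Hölder continuous in `(s, ξ)`
uniformly in `τ`, and `φ > δ` keeps the radicand away from `0`. In this algebra the reciprocal and
the square root are smooth where they make sense (`HolderFamily.contDiffOn_inv`,
`HolderFamily.contDiffOn_sqrt`): their increments factor as `F g - F f = (g - f) * Q`, so their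
derivatives are expressed through the maps themselves and smoothness bootstraps.

*The integrals.* The substitution `r = s - t p_σ` on `Z_φ` turns `𝓗(φ)(s)` into the integral of
`ℳ / p_σ + ℳ̄ / 2` (`integrable_fieldIntegrand_and_calH_eq`). Both integrals are bounded linear
functionals of a kernel. For the singular one this holds because the kernel
`Λ₁ 𝒦` vanishes at `ξ = 0` and hence is `O(|t p_σ|^α)`, which makes the factor `1 / p_σ` integrable.
Continuous linear maps commute with iterated derivatives, and this is the derivative formula
(`derivative_formula`).

*The target space.* The function `𝓗(φ)` and its derivative in `s` are combinations of the regular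
operator and of the bilinear singular operator `S(g, a)`, applied to `g = φ'` or `g = φ''` and to
smooth kernels `a`. The decisive estimate is that `S` is bounded from `C^{0,α} × KernelAlgebra α`
to `C^{0,α}` (`isBoundedBilinearMap_singularOperator`). Estimating the increment of the integrand by
its absolute value would lose a logarithm. For `|t p_σ|` larger than the increment `h`, however, the
oscillations of `g` at the two points differ by a difference of averages of `g`, which gains the
factor `h / |t p_σ|`, and by a constant; the constant meets a weight that is odd in `t` and a kernel
that is even in `t` up to `O(|t p_σ|^α)` (`KernelAlgebra.abs_difference_le`). A scaling argument
then bounds the integral by a multiple of `h^α` (`integrable_profileMajorant`).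

Finally, the bounded operator `(1 - d/ds)⁻¹ : C^{0,α} → C^{1,α}` (`HolderLine.resolvent`) recovers a
function from the difference between the function and its derivative, so that smoothness of both as
maps into `C^{0,α}` gives smoothness of `𝓗` as a map into `C^{1,α}` (`exists_smooth_operator`).
-/

namespace ExceptionalDomain

noncomputable section

open Filter Topology BoundedContinuousFunction

/-! ### The algebra of uniformly Hölder continuous families -/

/-- The algebra of bounded continuous functions `f : X × Y → ℝ` that are `α`-Hölder continuous in
the first variable, uniformly in the second one. For a one-point space `Y` it is the Hölder space
`C^{0,α}(X)`. -/
def holderFamilySubalgebra (X Y : Type) [MetricSpace X] [TopologicalSpace Y] (α : ℝ≥0) :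
    Subalgebra ℝ (X × Y →ᵇ ℝ) where
  carrier := {f | ∃ C : ℝ, 0 ≤ C ∧ ∀ x x' y, |f (x, y) - f (x', y)| ≤ C * dist x x' ^ (α : ℝ)}
  mul_mem' := by
    rintro f g ⟨C, hC, hf⟩ ⟨D, hD, hg⟩
    refine ⟨‖f‖ * D + ‖g‖ * C, by positivity, fun x x' y => ?_⟩
    have h : (f * g) (x, y) - (f * g) (x', y) =
        f (x, y) * (g (x, y) - g (x', y)) + g (x', y) * (f (x, y) - f (x', y)) := by
      simp only [BoundedContinuousFunction.mul_apply]; ring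
    rw [h, add_mul, mul_assoc, mul_assoc]
    refine (abs_add_le _ _).trans ?_
    rw [abs_mul, abs_mul]
    exact add_le_add (mul_le_mul (f.norm_coe_le_norm _) (hg x x' y) (abs_nonneg _) (norm_nonneg _))
      (mul_le_mul (g.norm_coe_le_norm _) (hf x x' y) (abs_nonneg _) (norm_nonneg _))
  add_mem' := by
    rintro f g ⟨C, hC, hf⟩ ⟨D, hD, hg⟩
    refine ⟨C + D, by positivity, fun x x' y => ?_⟩
    have h : (f + g) (x, y) - (f + g) (x', y) =
        (f (x, y) - f (x', y)) + (g (x, y) - g (x', y)) := by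
      simp only [BoundedContinuousFunction.add_apply]; ring
    rw [h, add_mul]
    exact (abs_add_le _ _).trans (add_le_add (hf x x' y) (hg x x' y))
  algebraMap_mem' := by
    intro r
    exact ⟨0, le_rfl, fun x x' y => by simp [BoundedContinuousFunction.algebraMap_apply]⟩

/-- The elements of `holderFamilySubalgebra`, as a type of its own so that it can carry the
Hölder norm instead of the supremum norm. -/
def HolderFamily (X Y : Type) [MetricSpace X] [TopologicalSpace Y] (α : ℝ≥0) : Type :=
  holderFamilySubalgebra X Y α

namespace HolderFamily

variable {X Y : Type} [MetricSpace X] [TopologicalSpace Y] {α : ℝ≥0}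

instance : CommRing (HolderFamily X Y α) :=
  inferInstanceAs (CommRing (holderFamilySubalgebra X Y α))

instance : Algebra ℝ (HolderFamily X Y α) :=
  inferInstanceAs (Algebra ℝ (holderFamilySubalgebra X Y α))

instance : CoeFun (HolderFamily X Y α) fun _ => X × Y → ℝ := ⟨fun f => f.1⟩

@[ext]
theorem ext {f g : HolderFamily X Y α} (h : ∀ x y, f (x, y) = g (x, y)) : f = g :=
  Subtype.ext (BoundedContinuousFunction.ext fun q => h q.1 q.2)

@[simp] theorem add_apply (f g : HolderFamily X Y α) (q : X × Y) : (f + g) q = f q + g q := rfl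
@[simp] theorem sub_apply (f g : HolderFamily X Y α) (q : X × Y) : (f - g) q = f q - g q := rfl
@[simp] theorem neg_apply (f : HolderFamily X Y α) (q : X × Y) : (-f) q = -f q := rfl
@[simp] theorem mul_apply (f g : HolderFamily X Y α) (q : X × Y) : (f * g) q = f q * g q := rfl
@[simp] theorem smul_apply (c : ℝ) (f : HolderFamily X Y α) (q : X × Y) :
    (c • f) q = c * f q := rfl
@[simp] theorem one_apply (q : X × Y) : (1 : HolderFamily X Y α) q = 1 := rfl
@[simp] theorem zero_apply (q : X × Y) : (0 : HolderFamily X Y α) q = 0 := rfl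

theorem continuous (f : HolderFamily X Y α) : Continuous f := f.1.continuous

/-- The best Hölder constant in the first variable, uniformly in the second. -/
def seminorm (f : HolderFamily X Y α) : ℝ :=
  ⨆ p : (X × X) × Y, |f (p.1.1, p.2) - f (p.1.2, p.2)| / dist p.1.1 p.1.2 ^ (α : ℝ)

theorem seminorm_nonneg (f : HolderFamily X Y α) : 0 ≤ f.seminorm :=
  Real.iSup_nonneg fun _ => by positivity

theorem seminorm_le {f : HolderFamily X Y α} {C : ℝ} (hC : 0 ≤ C)
    (h : ∀ x x' y, |f (x, y) - f (x', y)| ≤ C * dist x x' ^ (α : ℝ)) : f.seminorm ≤ C :=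
  Real.iSup_le (fun _ => div_le_of_le_mul₀ (by positivity) hC (h _ _ _)) hC

theorem abs_sub_le_seminorm (f : HolderFamily X Y α) (x x' : X) (y : Y) :
    |f (x, y) - f (x', y)| ≤ f.seminorm * dist x x' ^ (α : ℝ) := by
  obtain ⟨C, hC, hf⟩ := f.2
  have hb : BddAbove (range fun p : (X × X) × Y =>
      |f (p.1.1, p.2) - f (p.1.2, p.2)| / dist p.1.1 p.1.2 ^ (α : ℝ)) := by
    refine ⟨C, ?_⟩
    rintro _ ⟨p, rfl⟩
    exact div_le_of_le_mul₀ (by positivity) hC (hf _ _ _)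
  rcases eq_or_ne x x' with rfl | hx
  · simpa using mul_nonneg f.seminorm_nonneg (by positivity)
  · have h := le_ciSup hb ((x, x'), y)
    have hd : 0 < dist x x' ^ (α : ℝ) := Real.rpow_pos_of_pos (dist_pos.mpr hx) _
    exact (div_le_iff₀ hd).mp h

/-- The sum of the supremum norm and the Hölder seminorm. -/
def ringNorm (X Y : Type) [MetricSpace X] [TopologicalSpace Y] (α : ℝ≥0) :
    RingNorm (HolderFamily X Y α) where
  toFun f := ‖f.1‖ + f.seminorm
  map_zero' := by
    have h : (0 : HolderFamily X Y α).seminorm = 0 :=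
      le_antisymm (seminorm_le le_rfl fun x x' y => by simp) (seminorm_nonneg _)
    rw [h, add_zero]
    exact norm_zero
  add_le' f g := by
    have h : (f + g).seminorm ≤ f.seminorm + g.seminorm := by
      refine seminorm_le (add_nonneg f.seminorm_nonneg g.seminorm_nonneg) fun x x' y => ?_
      have e : (f + g) (x, y) - (f + g) (x', y) =
        (f (x, y) - f (x', y)) + (g (x, y) - g (x', y)) := by simp only [add_apply]; ring
      rw [e, add_mul]
      exact (abs_add_le _ _).trans
        (add_le_add (f.abs_sub_le_seminorm x x' y) (g.abs_sub_le_seminorm x x' y))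
    have h2 : ‖(f + g).1‖ ≤ ‖f.1‖ + ‖g.1‖ := norm_add_le f.1 g.1
    linarith
  neg' f := by
    have h : ∀ f : HolderFamily X Y α, (-f).seminorm ≤ f.seminorm := fun f =>
      seminorm_le f.seminorm_nonneg fun x x' y => by
        have := f.abs_sub_le_seminorm x x' y
        rw [abs_sub_comm] at this
        simpa only [neg_apply, neg_sub_neg] using this
    have h1 : (-f).seminorm = f.seminorm :=
      le_antisymm (h f) (by simpa using h (-f))
    rw [h1]
    congr 1
    exact norm_neg f.1
  mul_le' f g := by
    have h : (f * g).seminorm ≤ ‖f.1‖ * g.seminorm + ‖g.1‖ * f.seminorm := by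
      have hf := f.seminorm_nonneg
      have hg := g.seminorm_nonneg
      refine seminorm_le (by positivity) fun x x' y => ?_
      have e : (f * g) (x, y) - (f * g) (x', y) =
          f (x, y) * (g (x, y) - g (x', y)) + g (x', y) * (f (x, y) - f (x', y)) := by
        simp only [mul_apply]; ring
      rw [e, add_mul, mul_assoc, mul_assoc]
      refine (abs_add_le _ _).trans ?_
      rw [abs_mul, abs_mul]
      exact add_le_add
        (mul_le_mul (f.1.norm_coe_le_norm _) (g.abs_sub_le_seminorm x x' y) (abs_nonneg _)
          (norm_nonneg _))
        (mul_le_mul (g.1.norm_coe_le_norm _) (f.abs_sub_le_seminorm x x' y) (abs_nonneg _)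
          (norm_nonneg _))
    have h2 : ‖(f * g).1‖ ≤ ‖f.1‖ * ‖g.1‖ := norm_mul_le f.1 g.1
    have h3 := mul_nonneg f.seminorm_nonneg g.seminorm_nonneg
    linarith
  eq_zero_of_map_eq_zero' f h := by
    have h1 : ‖f.1‖ + f.seminorm = 0 := h
    have h2 : ‖f.1‖ = 0 := by
      have := f.seminorm_nonneg
      have := norm_nonneg f.1
      linarith
    exact Subtype.ext (norm_eq_zero.mp h2)

instance : NormedCommRing (HolderFamily X Y α) :=
  { (ringNorm X Y α).toNormedRing with mul_comm := mul_comm }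

theorem norm_def (f : HolderFamily X Y α) : ‖f‖ = ‖f.1‖ + f.seminorm := rfl

theorem abs_apply_le (f : HolderFamily X Y α) (q : X × Y) : |f q| ≤ ‖f‖ := by
  have h := f.1.norm_coe_le_norm q
  have := f.seminorm_nonneg
  rw [Real.norm_eq_abs] at h
  rw [norm_def]
  linarith

theorem abs_sub_le (f : HolderFamily X Y α) (x x' : X) (y : Y) :
    |f (x, y) - f (x', y)| ≤ ‖f‖ * dist x x' ^ (α : ℝ) := by
  refine (f.abs_sub_le_seminorm x x' y).trans
    (mul_le_mul_of_nonneg_right ?_ (by positivity))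
  rw [norm_def]
  linarith [norm_nonneg f.1]

theorem norm_le {f : HolderFamily X Y α} {C D : ℝ} (hC : 0 ≤ C) (hD : 0 ≤ D)
    (h : ∀ q, |f q| ≤ C) (h' : ∀ x x' y, |f (x, y) - f (x', y)| ≤ D * dist x x' ^ (α : ℝ)) :
    ‖f‖ ≤ C + D :=
  add_le_add ((BoundedContinuousFunction.norm_le hC).mpr h) (seminorm_le hD h')

instance : NormedAlgebra ℝ (HolderFamily X Y α) where
  norm_smul_le c f := by
    have hf := f.seminorm_nonneg
    have h : ‖c • f‖ ≤ ‖c‖ * ‖f.1‖ + ‖c‖ * f.seminorm := by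
      refine norm_le (by positivity) (by positivity) (fun q => ?_) fun x x' y => ?_
      · rw [smul_apply, abs_mul]
        exact mul_le_mul_of_nonneg_left (f.1.norm_coe_le_norm q) (norm_nonneg c)
      · rw [smul_apply, smul_apply, ← mul_sub, abs_mul, mul_assoc]
        exact mul_le_mul_of_nonneg_left (f.abs_sub_le_seminorm x x' y) (norm_nonneg c)
    rwa [← mul_add, ← norm_def] at h

/-- The family given by a bounded continuous function with a uniform Hölder constant. -/
def mk (f : X × Y → ℝ) (hf : Continuous f) (C D : ℝ) (hD : 0 ≤ D) (h : ∀ q, |f q| ≤ C)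
    (h' : ∀ x x' y, |f (x, y) - f (x', y)| ≤ D * dist x x' ^ (α : ℝ)) : HolderFamily X Y α :=
  ⟨BoundedContinuousFunction.ofNormedAddCommGroup f hf C h, D, hD, h'⟩

@[simp] theorem mk_apply (f : X × Y → ℝ) (hf : Continuous f) (C D : ℝ) (hD : 0 ≤ D)
    (h : ∀ q, |f q| ≤ C)
    (h' : ∀ x x' y, |f (x, y) - f (x', y)| ≤ D * dist x x' ^ (α : ℝ)) (q : X × Y) :
    (mk f hf C D hD h h' : HolderFamily X Y α) q = f q := rfl

/-- Evaluation at a point. -/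
def eval (q : X × Y) : HolderFamily X Y α →L[ℝ] ℝ :=
  LinearMap.mkContinuous
    { toFun := fun f => f q, map_add' := fun _ _ => rfl, map_smul' := fun _ _ => rfl } 1
    fun f => by
      rw [one_mul]
      exact f.abs_apply_le q

/-- A bounded linear map into a space of families, given by its values. -/
def ofLinear {E : Type*} [NormedAddCommGroup E] [NormedSpace ℝ E] (F : E →ₗ[ℝ] (X × Y → ℝ))
    (C D : ℝ) (hC : 0 ≤ C) (hD : 0 ≤ D) (hF : ∀ e, Continuous (F e))
    (h : ∀ e q, |F e q| ≤ C * ‖e‖)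
    (h' : ∀ e x x' y, |F e (x, y) - F e (x', y)| ≤ D * ‖e‖ * dist x x' ^ (α : ℝ)) :
    E →L[ℝ] HolderFamily X Y α :=
  LinearMap.mkContinuous
    { toFun := fun e => mk (F e) (hF e) (C * ‖e‖) (D * ‖e‖) (by positivity) (h e) (h' e)
      map_add' := fun e e' => by
        ext x y
        simp
      map_smul' := fun c e => by
        ext x y
        simp } (C + D) fun e => by
      rw [add_mul]
      exact norm_le (by positivity) (by positivity) (h e) (h' e)

/-! ### Reciprocals and square roots of families bounded away from zero -/

/-- The families with a positive lower bound. -/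
def positive (X Y : Type) [MetricSpace X] [TopologicalSpace Y] (α : ℝ≥0) :
    Set (HolderFamily X Y α) :=
  {f | ∃ c : ℝ, 0 < c ∧ ∀ q, c ≤ f q}

theorem isOpen_positive : IsOpen (positive X Y α) := by
  rw [Metric.isOpen_iff]
  rintro f ⟨c, hc, hf⟩
  refine ⟨c / 2, half_pos hc, fun g hg => ⟨c / 2, half_pos hc, fun q => ?_⟩⟩
  rw [Metric.mem_ball, dist_eq_norm] at hg
  have h := ((g - f).abs_apply_le q).trans hg.le
  have := (abs_le.mp h).1
  rw [sub_apply] at this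
  linarith [hf q]

theorem pos_of_mem_positive {f : HolderFamily X Y α} (hf : f ∈ positive X Y α) (q : X × Y) :
    0 < f q := by
  obtain ⟨c, hc, h⟩ := hf
  exact hc.trans_le (h q)

theorem abs_inv_sub_inv_le {c a b : ℝ} (hc : 0 < c) (ha : c ≤ a) (hb : c ≤ b) :
    |a⁻¹ - b⁻¹| ≤ (c⁻¹ * c⁻¹) * |a - b| := by
  have ha' := hc.trans_le ha
  have hb' := hc.trans_le hb
  have e : a⁻¹ - b⁻¹ = (a⁻¹ * b⁻¹) * (b - a) := by field_simp
  rw [e, abs_mul, abs_of_pos (by positivity), abs_sub_comm b a]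
  gcongr

theorem abs_sqrt_sub_sqrt_le {c a b : ℝ} (hc : 0 < c) (ha : c ≤ a) (hb : c ≤ b) :
    |√a - √b| ≤ (√c)⁻¹ * |a - b| := by
  have ha' := hc.trans_le ha
  have hb' := hc.trans_le hb
  have h1 := Real.sqrt_le_sqrt ha
  have h2 := Real.sqrt_nonneg b
  have h3 : 0 < √c := Real.sqrt_pos.mpr hc
  have e : a - b = (√a + √b) * (√a - √b) := by
    rw [← sq_sub_sq, Real.sq_sqrt ha'.le, Real.sq_sqrt hb'.le]
  have h4 : √c * |√a - √b| ≤ |a - b| := by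
    rw [e, abs_mul, abs_of_nonneg (by positivity : 0 ≤ √a + √b)]
    gcongr
    linarith
  rw [inv_mul_eq_div, le_div_iff₀ h3]
  linarith

open Classical in
/-- The pointwise reciprocal of a family with a positive lower bound (`0` for all others). -/
def inv (f : HolderFamily X Y α) : HolderFamily X Y α :=
  if h : f ∈ positive X Y α then
    mk (fun q => (f q)⁻¹) (f.continuous.inv₀ fun q => (pos_of_mem_positive h q).ne')
      h.choose⁻¹ (h.choose⁻¹ * h.choose⁻¹ * ‖f‖)
      (by have := h.choose_spec.1; positivity)
      (fun q => by
        have h1 := h.choose_spec.1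
        have h2 := h.choose_spec.2 q
        rw [abs_of_pos (inv_pos.mpr (h1.trans_le h2))]
        exact inv_anti₀ h1 h2)
      (fun x x' y => by
        rw [mul_assoc]
        have h1 := h.choose_spec.1
        exact (abs_inv_sub_inv_le h1 (h.choose_spec.2 _) (h.choose_spec.2 _)).trans
          (mul_le_mul_of_nonneg_left (f.abs_sub_le x x' y) (by positivity)))
  else 0

open Classical in
/-- The pointwise square root of a family with a positive lower bound (`0` for all others). -/
def sqrt (f : HolderFamily X Y α) : HolderFamily X Y α :=
  if h : f ∈ positive X Y α then
    mk (fun q => √(f q)) f.continuous.sqrt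
      (√‖f‖) ((√h.choose)⁻¹ * ‖f‖)
      (by positivity)
      (fun q => by
        rw [abs_of_nonneg (Real.sqrt_nonneg _)]
        exact Real.sqrt_le_sqrt ((le_abs_self _).trans (f.abs_apply_le q)))
      (fun x x' y => by
        rw [mul_assoc]
        have h1 := h.choose_spec.1
        exact (abs_sqrt_sub_sqrt_le h1 (h.choose_spec.2 _) (h.choose_spec.2 _)).trans
          (mul_le_mul_of_nonneg_left (f.abs_sub_le x x' y) (by positivity)))
  else 0

theorem inv_apply {f : HolderFamily X Y α} (hf : f ∈ positive X Y α) (q : X × Y) :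
    inv f q = (f q)⁻¹ := by
  rw [inv, dif_pos hf, mk_apply]

theorem sqrt_apply {f : HolderFamily X Y α} (hf : f ∈ positive X Y α) (q : X × Y) :
    sqrt f q = √(f q) := by
  rw [sqrt, dif_pos hf, mk_apply]

theorem norm_inv_le {f : HolderFamily X Y α} {c : ℝ} (hc : 0 < c) (hf : ∀ q, c ≤ f q) :
    ‖inv f‖ ≤ c⁻¹ + c⁻¹ * c⁻¹ * ‖f‖ := by
  have hp : f ∈ positive X Y α := ⟨c, hc, hf⟩
  refine norm_le (by positivity) (by positivity) (fun q => ?_) fun x x' y => ?_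
  · rw [inv_apply hp, abs_of_pos (inv_pos.mpr (hc.trans_le (hf q)))]
    exact inv_anti₀ hc (hf q)
  · rw [inv_apply hp, inv_apply hp, mul_assoc]
    exact (abs_inv_sub_inv_le hc (hf _) (hf _)).trans
      (mul_le_mul_of_nonneg_left (f.abs_sub_le x x' y) (by positivity))

theorem norm_sqrt_le {f : HolderFamily X Y α} {c : ℝ} (hc : 0 < c) (hf : ∀ q, c ≤ f q) :
    ‖sqrt f‖ ≤ √‖f‖ + (√c)⁻¹ * ‖f‖ := by
  have hp : f ∈ positive X Y α := ⟨c, hc, hf⟩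
  refine norm_le (by positivity) (by positivity) (fun q => ?_) fun x x' y => ?_
  · rw [sqrt_apply hp, abs_of_nonneg (Real.sqrt_nonneg _)]
    exact Real.sqrt_le_sqrt ((le_abs_self _).trans (f.abs_apply_le q))
  · rw [sqrt_apply hp, sqrt_apply hp, mul_assoc]
    exact (abs_sqrt_sub_sqrt_le hc (hf _) (hf _)).trans
      (mul_le_mul_of_nonneg_left (f.abs_sub_le x x' y) (by positivity))

theorem sqrt_mem_positive {f : HolderFamily X Y α} (hf : f ∈ positive X Y α) :
    sqrt f ∈ positive X Y α := by
  obtain ⟨c, hc, h⟩ := id hf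
  exact ⟨√c, Real.sqrt_pos.mpr hc, fun q => by
    rw [sqrt_apply hf]
    exact Real.sqrt_le_sqrt (h q)⟩

theorem add_mem_positive {f g : HolderFamily X Y α} (hf : f ∈ positive X Y α)
    (hg : g ∈ positive X Y α) : f + g ∈ positive X Y α := by
  obtain ⟨c, hc, h⟩ := hf
  exact ⟨c, hc, fun q => by
    rw [add_apply]
    linarith [h q, pos_of_mem_positive hg q]⟩

theorem inv_sub_inv {f g : HolderFamily X Y α} (hf : f ∈ positive X Y α)
    (hg : g ∈ positive X Y α) : inv g - inv f = (g - f) * (-(inv f * inv g)) := by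
  ext x y
  have h1 := (pos_of_mem_positive hf (x, y)).ne'
  have h2 := (pos_of_mem_positive hg (x, y)).ne'
  simp only [sub_apply, mul_apply, neg_apply, inv_apply hf, inv_apply hg]
  field_simp
  ring

theorem sqrt_sub_sqrt {f g : HolderFamily X Y α} (hf : f ∈ positive X Y α)
    (hg : g ∈ positive X Y α) :
    sqrt g - sqrt f = (g - f) * inv (sqrt f + sqrt g) := by
  ext x y
  have hf' := pos_of_mem_positive hf (x, y)
  have hg' := pos_of_mem_positive hg (x, y)
  have h1 := Real.sqrt_pos.mpr hf'
  have h2 := Real.sqrt_pos.mpr hg'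
  simp only [sub_apply, mul_apply, inv_apply (add_mem_positive (sqrt_mem_positive hf)
    (sqrt_mem_positive hg)), add_apply, sqrt_apply hf, sqrt_apply hg]
  rw [eq_mul_inv_iff_mul_eq₀ (by positivity)]
  have e1 := Real.sq_sqrt hf'.le
  have e2 := Real.sq_sqrt hg'.le
  linear_combination e2 - e1

/-- A locally bounded map whose increments factor through the increment of the argument, with
locally bounded quotient, is continuous. -/
theorem continuousAt_of_sub_eq {A : Type*} [NormedCommRing A] {F : A → A} {f : A} {Q : A → A}
    (h : ∀ᶠ g in 𝓝 f, F g - F f = (g - f) * Q g) {C : ℝ} (hQ : ∀ᶠ g in 𝓝 f, ‖Q g‖ ≤ C) :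
    ContinuousAt F f := by
  rw [ContinuousAt, tendsto_iff_norm_sub_tendsto_zero]
  have h0 : Tendsto (fun g => ‖g - f‖ * C) (𝓝 f) (𝓝 0) := by
    have : Tendsto (fun g => ‖g - f‖ * C) (𝓝 f) (𝓝 (‖f - f‖ * C)) :=
      Continuous.tendsto (by fun_prop) f
    simpa using this
  refine squeeze_zero' (Eventually.of_forall fun _ => norm_nonneg _) ?_ h0
  filter_upwards [h, hQ] with g hg hQg
  rw [hg]
  exact (norm_mul_le _ _).trans (mul_le_mul_of_nonneg_left hQg (norm_nonneg _))

/-- If the increments of `F` factor as `F g - F f = (g - f) * Q g` with `Q` continuous at `f`,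
then `F` is differentiable at `f`, with derivative the multiplication by `Q f`. -/
theorem hasFDerivAt_of_sub_eq {A : Type*} [NormedCommRing A] [NormedAlgebra ℝ A] {F : A → A}
    {f : A} {Q : A → A} (h : ∀ᶠ g in 𝓝 f, F g - F f = (g - f) * Q g) (hQ : ContinuousAt Q f) :
    HasFDerivAt F (ContinuousLinearMap.mul ℝ A (Q f)) f := by
  rw [hasFDerivAt_iff_isLittleO, Asymptotics.isLittleO_iff]
  intro c hc
  have hQ' : ∀ᶠ g in 𝓝 f, ‖Q g - Q f‖ ≤ c := by
    filter_upwards [Metric.continuousAt_iff'.mp hQ c hc] with g hg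
    rw [← dist_eq_norm]
    exact hg.le
  filter_upwards [h, hQ'] with g hg hQg
  rw [hg, ContinuousLinearMap.mul_apply',
    show (g - f) * Q g - Q f * (g - f) = (Q g - Q f) * (g - f) by ring]
  exact (norm_mul_le _ _).trans (mul_le_mul_of_nonneg_right hQg (norm_nonneg _))

/-- Near a family with lower bound `c`, all families have lower bound `c / 2` and bounded norm. -/
theorem eventually_lower_bound {f : HolderFamily X Y α} {c : ℝ} (hc : 0 < c)
    (hf : ∀ q, c ≤ f q) :
    ∀ᶠ g in 𝓝 f, (∀ q, c / 2 ≤ g q) ∧ ‖g‖ ≤ ‖f‖ + 1 := by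
  filter_upwards [Metric.ball_mem_nhds f (half_pos hc), Metric.ball_mem_nhds f one_pos]
    with g hg hg'
  rw [Metric.mem_ball, dist_eq_norm] at hg hg'
  refine ⟨fun q => ?_, ?_⟩
  · have h := (abs_le.mp (((g - f).abs_apply_le q).trans hg.le)).1
    rw [sub_apply] at h
    linarith [hf q]
  · have := norm_le_norm_add_norm_sub' g f
    linarith

theorem continuousAt_inv {f : HolderFamily X Y α} (hf : f ∈ positive X Y α) :
    ContinuousAt inv f := by
  obtain ⟨c, hc, h⟩ := id hf
  have hev : ∀ᶠ g in 𝓝 f, g ∈ positive X Y α := isOpen_positive.mem_nhds hf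
  refine continuousAt_of_sub_eq (hev.mono fun g hg => inv_sub_inv hf hg)
    (C := ‖inv f‖ * ((c / 2)⁻¹ + (c / 2)⁻¹ * (c / 2)⁻¹ * (‖f‖ + 1))) ?_
  filter_upwards [eventually_lower_bound hc h] with g hg
  rw [norm_neg]
  refine (norm_mul_le _ _).trans (mul_le_mul_of_nonneg_left ?_ (norm_nonneg _))
  refine (norm_inv_le (half_pos hc) hg.1).trans ?_
  gcongr
  exact hg.2

theorem continuousAt_sqrt {f : HolderFamily X Y α} (hf : f ∈ positive X Y α) :
    ContinuousAt sqrt f := by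
  obtain ⟨c, hc, h⟩ := id hf
  have hev : ∀ᶠ g in 𝓝 f, g ∈ positive X Y α := isOpen_positive.mem_nhds hf
  have hc' : 0 < √c := Real.sqrt_pos.mpr hc
  refine continuousAt_of_sub_eq (hev.mono fun g hg => sqrt_sub_sqrt hf hg)
    (C := (√c)⁻¹ + (√c)⁻¹ * (√c)⁻¹ *
      (‖sqrt f‖ + (√(‖f‖ + 1) + (√(c / 2))⁻¹ * (‖f‖ + 1)))) ?_
  filter_upwards [eventually_lower_bound hc h, hev] with g hg hgp
  have hlow : ∀ q, √c ≤ (sqrt f + sqrt g) q := fun q => by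
    rw [add_apply, sqrt_apply hf, sqrt_apply hgp]
    linarith [Real.sqrt_le_sqrt (h q), Real.sqrt_nonneg (g q)]
  refine (norm_inv_le hc' hlow).trans ?_
  gcongr
  refine (norm_add_le _ _).trans ?_
  gcongr
  refine (norm_sqrt_le (half_pos hc) hg.1).trans ?_
  gcongr
  · exact hg.2
  · exact hg.2

theorem hasFDerivAt_inv {f : HolderFamily X Y α} (hf : f ∈ positive X Y α) :
    HasFDerivAt inv (ContinuousLinearMap.mul ℝ _ (-(inv f * inv f))) f := by
  have hev : ∀ᶠ g in 𝓝 f, g ∈ positive X Y α := isOpen_positive.mem_nhds hf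
  exact hasFDerivAt_of_sub_eq (Q := fun g => -(inv f * inv g))
    (hev.mono fun g hg => inv_sub_inv hf hg)
    (continuousAt_const.mul (continuousAt_inv hf)).neg

theorem hasFDerivAt_sqrt {f : HolderFamily X Y α} (hf : f ∈ positive X Y α) :
    HasFDerivAt sqrt (ContinuousLinearMap.mul ℝ _ (inv (sqrt f + sqrt f))) f := by
  have hev : ∀ᶠ g in 𝓝 f, g ∈ positive X Y α := isOpen_positive.mem_nhds hf
  refine hasFDerivAt_of_sub_eq (Q := fun g => inv (sqrt f + sqrt g))
    (hev.mono fun g hg => sqrt_sub_sqrt hf hg) ?_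
  have h := sqrt_mem_positive hf
  exact ContinuousAt.comp (f := fun g => sqrt f + sqrt g)
    (continuousAt_inv (add_mem_positive h h)) (continuousAt_const.add (continuousAt_sqrt hf))

theorem contDiffOn_inv : ContDiffOn ℝ ∞ (inv : HolderFamily X Y α → _) (positive X Y α) := by
  rw [contDiffOn_infty]
  intro n
  induction n with
  | zero =>
    exact contDiffOn_zero.mpr fun f hf => (continuousAt_inv hf).continuousWithinAt
  | succ n ih =>
    push_cast
    rw [contDiffOn_succ_iff_hasFDerivWithinAt_of_uniqueDiffOn isOpen_positive.uniqueDiffOn]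
    exact ⟨by simp, _, (ContinuousLinearMap.mul ℝ (HolderFamily X Y α)).contDiff.comp_contDiffOn
      (ih.mul ih).neg, fun f hf => (hasFDerivAt_inv hf).hasFDerivWithinAt⟩

theorem contDiffOn_sqrt : ContDiffOn ℝ ∞ (sqrt : HolderFamily X Y α → _) (positive X Y α) := by
  rw [contDiffOn_infty]
  intro n
  induction n with
  | zero =>
    exact contDiffOn_zero.mpr fun f hf => (continuousAt_sqrt hf).continuousWithinAt
  | succ n ih =>
    push_cast
    rw [contDiffOn_succ_iff_hasFDerivWithinAt_of_uniqueDiffOn isOpen_positive.uniqueDiffOn]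
    refine ⟨by simp, _, (ContinuousLinearMap.mul ℝ (HolderFamily X Y α)).contDiff.comp_contDiffOn
      (((contDiffOn_infty.mp contDiffOn_inv n).comp (ih.add ih) fun f hf => ?_)),
      fun f hf => (hasFDerivAt_sqrt hf).hasFDerivWithinAt⟩
    exact add_mem_positive (sqrt_mem_positive hf) (sqrt_mem_positive hf)

end HolderFamily

end

noncomputable section

open Filter Topology

/-! ### Jets, translates and averages as bounded linear maps -/

/-- The space `C^{0,α}(ℝ)`. -/
abbrev HolderLine (α : ℝ≥0) : Type := HolderFamily ℝ Unit α

/-- The algebra of kernels `f ((s, ξ), τ)`: bounded, continuous, and `α`-Hölder continuous in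
`(s, ξ)`, uniformly in `τ`. -/
abbrev KernelAlgebra (α : ℝ≥0) : Type := HolderFamily (ℝ × ℝ) ℝ α

variable {α : ℝ≥0}

namespace HolderSpace

variable {j : ℕ}

theorem abs_iteratedDeriv_le (u : HolderSpace j α) {i : ℕ} (hi : i ≤ j) (x : ℝ) :
    |iteratedDeriv i u x| ≤ ‖u‖ := by
  rw [norm_def]
  have h1 := le_ciSup (u.2.2.1 i hi) x
  have h2 : (⨆ x, |iteratedDeriv i u x|) ≤
      ∑ i ∈ Finset.range (j + 1), ⨆ x, |iteratedDeriv i u x| :=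
    Finset.single_le_sum (f := fun i => ⨆ x, |iteratedDeriv i u x|)
      (fun i _ => Real.iSup_nonneg fun x => abs_nonneg _)
      (Finset.mem_range.mpr (Nat.lt_succ_of_le hi))
  have h3 := NNReal.coe_nonneg (nnHolderNorm α (iteratedDeriv j u))
  exact h1.trans (h2.trans (le_add_of_nonneg_right h3))

theorem abs_apply_le (u : HolderSpace j α) (x : ℝ) : |u x| ≤ ‖u‖ := by
  simpa using abs_iteratedDeriv_le u (Nat.zero_le j) x

theorem hasDerivAt_iteratedDeriv (u : HolderSpace j α) {i : ℕ} (hi : i < j) (x : ℝ) :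
    HasDerivAt (iteratedDeriv i u) (iteratedDeriv (i + 1) u x) x := by
  rw [iteratedDeriv_succ]
  exact (u.2.1.differentiable_iteratedDeriv i (by exact_mod_cast hi) x).hasDerivAt

theorem continuous_iteratedDeriv (u : HolderSpace j α) {i : ℕ} (hi : i ≤ j) :
    Continuous (iteratedDeriv i u) :=
  u.2.1.continuous_iteratedDeriv i (by exact_mod_cast hi)

/-- A bound for `f` and a Lipschitz bound give a Hölder bound. -/
theorem holder_of_lipschitz {X : Type*} [MetricSpace X] {f : X → ℝ} {M L : ℝ} (hα : α ≤ 1)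
    (hM : 0 ≤ M) (hL : 0 ≤ L) (h : ∀ x, |f x| ≤ M) (h' : ∀ x y, |f x - f y| ≤ L * dist x y)
    (x y : X) : |f x - f y| ≤ (2 * M + L) * dist x y ^ (α : ℝ) := by
  rcases le_total (dist x y) 1 with h1 | h1
  · have h2 : dist x y ≤ dist x y ^ (α : ℝ) := by
      rcases eq_or_lt_of_le (dist_nonneg (x := x) (y := y)) with h0 | h0
      · rw [← h0]; positivity
      · simpa using Real.rpow_le_rpow_of_exponent_ge h0 h1 (by exact_mod_cast hα : (α : ℝ) ≤ 1)
    have h3 : 0 ≤ dist x y ^ (α : ℝ) := by positivity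
    have h4 := h' x y
    nlinarith [mul_le_mul_of_nonneg_left h2 hL, mul_nonneg hM h3]
  · have h2 : 1 ≤ dist x y ^ (α : ℝ) := Real.one_le_rpow h1 α.2
    have h3 : |f x - f y| ≤ 2 * M := by
      have := abs_sub (f x) (f y)
      linarith [h x, h y]
    nlinarith

theorem abs_iteratedDeriv_sub_le (u : HolderSpace j α) (hα : α ≤ 1) {i : ℕ} (hi : i ≤ j)
    (x y : ℝ) :
    |iteratedDeriv i u x - iteratedDeriv i u y| ≤ 3 * ‖u‖ * dist x y ^ (α : ℝ) := by
  rcases hi.lt_or_eq with hi' | rfl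
  · have h := holder_of_lipschitz (f := iteratedDeriv i u) hα (norm_nonneg u) (norm_nonneg u)
      (u.abs_iteratedDeriv_le hi) (fun x y => by
        have := convex_univ.norm_image_sub_le_of_norm_hasDerivWithin_le
          (fun z _ => (u.hasDerivAt_iteratedDeriv hi' z).hasDerivWithinAt)
          (fun z _ => u.abs_iteratedDeriv_le hi' z) (mem_univ y) (mem_univ x)
        rwa [Real.norm_eq_abs, ← dist_eq_norm] at this) x y
    linarith
  · have h := u.2.2.2.holderWith.dist_le x y
    rw [Real.dist_eq] at h
    refine h.trans (mul_le_mul_of_nonneg_right ?_ (by positivity))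
    have h1 : (nnHolderNorm α (iteratedDeriv i u) : ℝ) ≤ ‖u‖ := by
      rw [norm_def]
      exact le_add_of_nonneg_left
        (Finset.sum_nonneg fun i _ => Real.iSup_nonneg fun x => abs_nonneg _)
    have := norm_nonneg u
    exact h1.trans (by linarith)

/-- The bounded linear map `u ↦ u^{(i)}` from `C^{j,α}(ℝ)` to `C^{0,α}(ℝ)`. -/
def jet (hα : α ≤ 1) (i : ℕ) (hi : i ≤ j) : HolderSpace j α →L[ℝ] HolderLine α :=
  HolderFamily.ofLinear
    { toFun := fun u q => iteratedDeriv i u q.1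
      map_add' := fun u v => by
        ext q
        rw [iteratedDeriv_coe_add u v hi]
        rfl
      map_smul' := fun c u => by
        ext q
        rw [iteratedDeriv_coe_smul c u hi]
        rfl } 1 3 zero_le_one zero_le_three
    (fun u => (u.continuous_iteratedDeriv hi).comp continuous_fst)
    (fun u q => by simpa using u.abs_iteratedDeriv_le hi q.1)
    (fun u x x' _ => u.abs_iteratedDeriv_sub_le hα hi x x')

@[simp] theorem jet_apply (hα : α ≤ 1) (i : ℕ) (hi : i ≤ j) (u : HolderSpace j α)
    (q : ℝ × Unit) : jet hα i hi u q = iteratedDeriv i u q.1 := rfl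

end HolderSpace

namespace KernelAlgebra

theorem dist_translate_rpow_le {ρ : ℝ} (hρ : ρ ∈ Icc (0 : ℝ) 1) (hα : α ≤ 1) (x x' : ℝ × ℝ) :
    dist (x.1 - ρ * x.2) (x'.1 - ρ * x'.2) ^ (α : ℝ) ≤ 2 * dist x x' ^ (α : ℝ) := by
  have h1 : dist (x.1 - ρ * x.2) (x'.1 - ρ * x'.2) ≤ 2 * dist x x' := by
    have e : x.1 - ρ * x.2 - (x'.1 - ρ * x'.2) = (x.1 - x'.1) - ρ * (x.2 - x'.2) := by ring
    have h2 : |x.1 - x'.1| ≤ dist x x' := le_max_left _ _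
    have h3 : |x.2 - x'.2| ≤ dist x x' := le_max_right _ _
    rw [Real.dist_eq, e]
    refine (abs_sub _ _).trans ?_
    rw [abs_mul, abs_of_nonneg hρ.1]
    nlinarith [mul_le_mul_of_nonneg_right hρ.2 (abs_nonneg (x.2 - x'.2))]
  calc dist (x.1 - ρ * x.2) (x'.1 - ρ * x'.2) ^ (α : ℝ) ≤ (2 * dist x x') ^ (α : ℝ) :=
        Real.rpow_le_rpow dist_nonneg h1 α.2
    _ = 2 ^ (α : ℝ) * dist x x' ^ (α : ℝ) := Real.mul_rpow zero_le_two dist_nonneg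
    _ ≤ 2 * dist x x' ^ (α : ℝ) := by
        refine mul_le_mul_of_nonneg_right ?_ (by positivity)
        simpa using Real.rpow_le_rpow_of_exponent_le one_le_two (by exact_mod_cast hα : (α : ℝ) ≤ 1)

theorem abs_translate_sub_le (hα : α ≤ 1) (g : HolderLine α) {ρ : ℝ} (hρ : ρ ∈ Icc (0 : ℝ) 1)
    (x x' : ℝ × ℝ) :
    |g (x.1 - ρ * x.2, ()) - g (x'.1 - ρ * x'.2, ())| ≤ 2 * ‖g‖ * dist x x' ^ (α : ℝ) := by
  refine (g.abs_sub_le _ _ _).trans ?_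
  have := mul_le_mul_of_nonneg_left (dist_translate_rpow_le hρ hα x x') (norm_nonneg g)
  linarith

/-- The bounded linear map `g ↦ g(s - ρ ξ)`. -/
def translate (hα : α ≤ 1) (ρ : Icc (0 : ℝ) 1) : HolderLine α →L[ℝ] KernelAlgebra α :=
  HolderFamily.ofLinear
    { toFun := fun g q => g (q.1.1 - ρ * q.1.2, ())
      map_add' := fun _ _ => rfl
      map_smul' := fun _ _ => rfl } 1 2 zero_le_one zero_le_two
    (fun g => g.continuous.comp (by fun_prop))
    (fun g q => by
      rw [one_mul]
      exact g.abs_apply_le _)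
    (fun g x x' _ => abs_translate_sub_le hα g ρ.2 x x')

@[simp] theorem translate_apply (hα : α ≤ 1) (ρ : Icc (0 : ℝ) 1) (g : HolderLine α)
    (q : (ℝ × ℝ) × ℝ) : translate hα ρ g q = g (q.1.1 - ρ * q.1.2, ()) := rfl

theorem continuous_segment (g : HolderLine α) (s ξ : ℝ) :
    Continuous fun ρ : ℝ => g (s - ρ * ξ, ()) :=
  g.continuous.comp (by fun_prop)

/-- The bounded linear map `g ↦ ∫₀¹ g(s - ρ ξ) dρ`. -/
def average (hα : α ≤ 1) : HolderLine α →L[ℝ] KernelAlgebra α :=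
  HolderFamily.ofLinear
    { toFun := fun g q => ∫ ρ in (0 : ℝ)..1, g (q.1.1 - ρ * q.1.2, ())
      map_add' := fun g g' => by
        ext q
        exact intervalIntegral.integral_add
          ((continuous_segment g _ _).intervalIntegrable _ _)
          ((continuous_segment g' _ _).intervalIntegrable _ _)
      map_smul' := fun c g => by
        ext q
        exact intervalIntegral.integral_const_mul c _ } 1 2 zero_le_one zero_le_two
    (fun g => by
      refine intervalIntegral.continuous_parametric_intervalIntegral_of_continuous' ?_ 0 1
      exact g.continuous.comp (by fun_prop))
    (fun g q => by
      have h := intervalIntegral.norm_integral_le_of_norm_le_const (a := (0 : ℝ)) (b := 1)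
        (f := fun ρ => g (q.1.1 - ρ * q.1.2, ())) (C := ‖g‖) fun ρ _ => g.abs_apply_le _
      simpa using h)
    (fun g x x' _ => by
      have h := intervalIntegral.norm_integral_le_of_norm_le_const (a := (0 : ℝ)) (b := 1)
        (f := fun ρ => g (x.1 - ρ * x.2, ()) - g (x'.1 - ρ * x'.2, ()))
        (C := 2 * ‖g‖ * dist x x' ^ (α : ℝ)) fun ρ hρ => by
          rw [uIoc_of_le zero_le_one] at hρ
          exact abs_translate_sub_le hα g ⟨hρ.1.le, hρ.2⟩ x x'
      rw [intervalIntegral.integral_sub ((continuous_segment g _ _).intervalIntegrable _ _)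
          ((continuous_segment g _ _).intervalIntegrable _ _)] at h
      simpa using h)

@[simp] theorem average_apply (hα : α ≤ 1) (g : HolderLine α) (q : (ℝ × ℝ) × ℝ) :
    average hα g q = ∫ ρ in (0 : ℝ)..1, g (q.1.1 - ρ * q.1.2, ()) := rfl

/-- The bounded linear map `g ↦ ∫₀¹ (g(s - ρ ξ) - g(s)) dρ`. Its values vanish for `ξ = 0`. -/
def oscillation (hα : α ≤ 1) : HolderLine α →L[ℝ] KernelAlgebra α :=
  average hα - translate hα 0

theorem oscillation_apply (hα : α ≤ 1) (g : HolderLine α) (s ξ τ : ℝ) :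
    oscillation hα g ((s, ξ), τ) = (∫ ρ in (0 : ℝ)..1, g (s - ρ * ξ, ())) - g (s, ()) := by
  change average hα g ((s, ξ), τ) - translate hα 0 g ((s, ξ), τ) = _
  simp

theorem oscillation_apply_zero (hα : α ≤ 1) (g : HolderLine α) (s τ : ℝ) :
    oscillation hα g ((s, 0), τ) = 0 := by
  rw [oscillation_apply]
  simp

/-- The kernel `1 / (1 + τ²)`. -/
def weight (α : ℝ≥0) : KernelAlgebra α :=
  HolderFamily.mk (fun q => 1 / (1 + q.2 ^ 2))
    (continuous_const.div (by fun_prop) fun q => by positivity) 1 0 le_rfl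
    (fun q => by
      rw [abs_of_pos (by positivity)]
      exact div_le_one_of_le₀ (by nlinarith [sq_nonneg q.2]) (by positivity))
    (fun x x' y => by simp)

@[simp] theorem weight_apply (q : (ℝ × ℝ) × ℝ) : weight α q = 1 / (1 + q.2 ^ 2) := rfl

/-! ### Smooth families of kernels with a derivative in `s` -/

/-- The kernel `f` is differentiable in `s`, with derivative the kernel `f'`. -/
def HasSDeriv (f f' : KernelAlgebra α) : Prop :=
  ∀ s ξ τ : ℝ, HasDerivAt (fun r => f ((r, ξ), τ)) (f' ((s, ξ), τ)) s

namespace HasSDeriv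

variable {f f' g g' : KernelAlgebra α}

theorem add (hf : HasSDeriv f f') (hg : HasSDeriv g g') : HasSDeriv (f + g) (f' + g') :=
  fun s ξ τ => (hf s ξ τ).add (hg s ξ τ)

theorem sub (hf : HasSDeriv f f') (hg : HasSDeriv g g') : HasSDeriv (f - g) (f' - g') :=
  fun s ξ τ => (hf s ξ τ).sub (hg s ξ τ)

theorem mul (hf : HasSDeriv f f') (hg : HasSDeriv g g') :
    HasSDeriv (f * g) (f' * g + f * g') :=
  fun s ξ τ => (hf s ξ τ).mul (hg s ξ τ)

theorem inv (hf : HasSDeriv f f') (hp : f ∈ HolderFamily.positive (ℝ × ℝ) ℝ α) :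
    HasSDeriv f.inv (-(f' * (f.inv * f.inv))) := by
  intro s ξ τ
  have h := (hf s ξ τ).inv (HolderFamily.pos_of_mem_positive hp _).ne'
  refine (h.congr_deriv ?_).congr_of_eventuallyEq
    (Eventually.of_forall fun r => HolderFamily.inv_apply hp _)
  simp only [HolderFamily.neg_apply, HolderFamily.mul_apply, HolderFamily.inv_apply hp]
  field_simp

theorem sqrt (hf : HasSDeriv f f') (hp : f ∈ HolderFamily.positive (ℝ × ℝ) ℝ α) :
    HasSDeriv f.sqrt (f' * (f.sqrt + f.sqrt).inv) := by
  intro s ξ τ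
  have hs := HolderFamily.sqrt_mem_positive hp
  have h := (hf s ξ τ).sqrt (HolderFamily.pos_of_mem_positive hp _).ne'
  refine (h.congr_deriv ?_).congr_of_eventuallyEq
    (Eventually.of_forall fun r => HolderFamily.sqrt_apply hp _)
  simp only [HolderFamily.mul_apply,
    HolderFamily.inv_apply (HolderFamily.add_mem_positive hs hs), HolderFamily.add_apply,
    HolderFamily.sqrt_apply hp]
  rw [← two_mul, div_eq_mul_inv]

end HasSDeriv

theorem hasSDeriv_translate (hα : α ≤ 1) (ρ : Icc (0 : ℝ) 1) {g g' : HolderLine α}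
    (h : ∀ s, HasDerivAt (fun r => g (r, ())) (g' (s, ())) s) :
    HasSDeriv (translate hα ρ g) (translate hα ρ g') := by
  intro s ξ τ
  exact (h (s - ρ * ξ)).comp_sub_const s (ρ * ξ)

theorem hasSDeriv_average (hα : α ≤ 1) {g g' : HolderLine α}
    (h : ∀ s, HasDerivAt (fun r => g (r, ())) (g' (s, ())) s) :
    HasSDeriv (average hα g) (average hα g') := by
  intro s ξ τ
  refine (intervalIntegral.hasDerivAt_integral_of_dominated_loc_of_deriv_le
    (F := fun r ρ => g (r - ρ * ξ, ())) (F' := fun r ρ => g' (r - ρ * ξ, ()))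
    (bound := fun _ => ‖g'‖) (s := univ) univ_mem
    (Eventually.of_forall fun r => (continuous_segment g r ξ).aestronglyMeasurable)
    ((continuous_segment g s ξ).intervalIntegrable _ _)
    (continuous_segment g' s ξ).aestronglyMeasurable
    (Eventually.of_forall fun ρ _ r _ => g'.abs_apply_le _)
    intervalIntegrable_const
    (Eventually.of_forall fun ρ _ r _ => (h (r - ρ * ξ)).comp_sub_const r (ρ * ξ))).2

theorem hasSDeriv_oscillation (hα : α ≤ 1) {g g' : HolderLine α}
    (h : ∀ s, HasDerivAt (fun r => g (r, ())) (g' (s, ())) s) :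
    HasSDeriv (oscillation hα g) (oscillation hα g') :=
  (hasSDeriv_average hα h).sub (hasSDeriv_translate hα 0 h)

/-- A map into the kernels that is smooth on `U`, and whose values are differentiable in `s` with a
derivative that is again a smooth map on `U`. -/
def SmoothWithSDeriv {V : Type*} [NormedAddCommGroup V] [NormedSpace ℝ V] (U : Set V)
    (F : V → KernelAlgebra α) : Prop :=
  ContDiffOn ℝ ∞ F U ∧ ∃ F' : V → KernelAlgebra α, ContDiffOn ℝ ∞ F' U ∧
    ∀ φ ∈ U, HasSDeriv (F φ) (F' φ)

namespace SmoothWithSDeriv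

variable {V : Type*} [NormedAddCommGroup V] [NormedSpace ℝ V] {U : Set V}
  {F G : V → KernelAlgebra α}

theorem add (hF : SmoothWithSDeriv U F) (hG : SmoothWithSDeriv U G) :
    SmoothWithSDeriv U fun φ => F φ + G φ := by
  obtain ⟨hF, F', hF', hf⟩ := hF
  obtain ⟨hG, G', hG', hg⟩ := hG
  exact ⟨hF.add hG, _, hF'.add hG', fun φ hφ => (hf φ hφ).add (hg φ hφ)⟩

theorem mul (hF : SmoothWithSDeriv U F) (hG : SmoothWithSDeriv U G) :
    SmoothWithSDeriv U fun φ => F φ * G φ := by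
  obtain ⟨hF, F', hF', hf⟩ := hF
  obtain ⟨hG, G', hG', hg⟩ := hG
  exact ⟨hF.mul hG, _, (hF'.mul hG).add (hF.mul hG'), fun φ hφ => (hf φ hφ).mul (hg φ hφ)⟩

theorem inv (hF : SmoothWithSDeriv U F)
    (hp : ∀ φ ∈ U, F φ ∈ HolderFamily.positive (ℝ × ℝ) ℝ α) :
    SmoothWithSDeriv U fun φ => (F φ).inv := by
  obtain ⟨hF, F', hF', hf⟩ := hF
  have h := HolderFamily.contDiffOn_inv.comp hF hp
  exact ⟨h, _, (hF'.mul (h.mul h)).neg, fun φ hφ => (hf φ hφ).inv (hp φ hφ)⟩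

theorem sqrt (hF : SmoothWithSDeriv U F)
    (hp : ∀ φ ∈ U, F φ ∈ HolderFamily.positive (ℝ × ℝ) ℝ α) :
    SmoothWithSDeriv U fun φ => (F φ).sqrt := by
  obtain ⟨hF, F', hF', hf⟩ := hF
  have h := HolderFamily.contDiffOn_sqrt.comp hF hp
  refine ⟨h, _, hF'.mul (HolderFamily.contDiffOn_inv.comp (h.add h) fun φ hφ => ?_),
    fun φ hφ => (hf φ hφ).sqrt (hp φ hφ)⟩
  have hs := HolderFamily.sqrt_mem_positive (hp φ hφ)
  exact HolderFamily.add_mem_positive hs hs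

theorem const {f : KernelAlgebra α} (hf : HasSDeriv f 0) :
    SmoothWithSDeriv U fun _ => f :=
  ⟨contDiffOn_const, fun _ => 0, contDiffOn_const, fun _ _ => hf⟩

theorem clm {L L' : V →L[ℝ] KernelAlgebra α} (h : ∀ φ, HasSDeriv (L φ) (L' φ)) :
    SmoothWithSDeriv U fun φ => L φ :=
  ⟨L.contDiff.contDiffOn, _, L'.contDiff.contDiffOn, fun φ _ => h φ⟩

end SmoothWithSDeriv

end KernelAlgebra

end

noncomputable section

open Filter Topology

/-! ### The chord length and the weights of the integrals -/

variable {α : ℝ≥0}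

theorem chord_eq_sqrt (θ : ℝ) : chord θ = √(2 - 2 * Real.cos θ) := by
  rw [chord, EuclideanSpace.norm_eq]
  congr 1
  simp only [Fin.sum_univ_two, PiLp.sub_apply, Real.norm_eq_abs, sq_abs]
  simp
  linarith [Real.sin_sq_add_cos_sq θ]

theorem chord_nonneg (θ : ℝ) : 0 ≤ chord θ := norm_nonneg _

theorem chord_sq (θ : ℝ) : chord θ ^ 2 = 2 - 2 * Real.cos θ := by
  rw [chord_eq_sqrt, Real.sq_sqrt]
  linarith [Real.cos_le_one θ]

theorem chord_eq_abs_sin (θ : ℝ) : chord θ = 2 * |Real.sin (θ / 2)| := by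
  rw [Real.abs_sin_half, chord_eq_sqrt, show 2 - 2 * Real.cos θ = 2 ^ 2 * ((1 - Real.cos θ) / 2) by
    ring, Real.sqrt_mul (by positivity), Real.sqrt_sq zero_le_two]

theorem continuous_chord : Continuous chord := by
  have : chord = fun θ => √(2 - 2 * Real.cos θ) := funext chord_eq_sqrt
  rw [this]
  fun_prop

theorem mul_abs_le_chord {θ : ℝ} (hθ : |θ| ≤ Real.pi) : 2 / Real.pi * |θ| ≤ chord θ := by
  have h := Real.mul_abs_le_abs_sin (x := θ / 2) (by
    rw [abs_div, abs_two]
    linarith)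
  rw [abs_div, abs_two] at h
  rw [chord_eq_abs_sin]
  linarith

theorem chord_pos {θ : ℝ} (hθ : |θ| ≤ Real.pi) (h0 : θ ≠ 0) : 0 < chord θ :=
  lt_of_lt_of_le (mul_pos (by positivity) (abs_pos.mpr h0)) (mul_abs_le_chord hθ)

/-- The decay factor `(1 + t²)^{-3/2}` of the kernels. -/
def decay (t : ℝ) : ℝ := (1 + t ^ 2) ^ (-(3 / 2) : ℝ)

theorem decay_pos (t : ℝ) : 0 < decay t := Real.rpow_pos_of_pos (by positivity) _

theorem decay_neg (t : ℝ) : decay (-t) = decay t := by rw [decay, decay, neg_sq]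

theorem continuous_decay : Continuous decay :=
  (by fun_prop : Continuous fun t : ℝ => 1 + t ^ 2).rpow_const fun t =>
    Or.inl (by positivity)

theorem integrable_decay_rpow {r : ℝ} (hr : 1 < r) :
    Integrable fun t : ℝ => (1 + t ^ 2) ^ (-r / 2) := by
  have h := integrable_rpow_neg_one_add_norm_sq (E := ℝ) (μ := volume) (r := r) (by simpa using hr)
  simpa using h

theorem integrable_decay : Integrable decay := by
  have h := integrable_decay_rpow (r := 3) (by norm_num)
  have e : (-3 / 2 : ℝ) = -(3 / 2) := by norm_num
  rw [e] at h
  exact h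

theorem abs_rpow_mul_decay_le {β : ℝ} (hβ : 0 ≤ β) (t : ℝ) :
    |t| ^ β * decay t ≤ (1 + t ^ 2) ^ (-(3 - β) / 2) := by
  have h1 : |t| ^ β ≤ (1 + t ^ 2) ^ (β / 2) := by
    have h2 : |t| ^ β = (t ^ 2) ^ (β / 2) := by
      rw [← sq_abs, ← Real.rpow_natCast, ← Real.rpow_mul (abs_nonneg t)]
      congr 1
      push_cast
      ring
    rw [h2]
    exact Real.rpow_le_rpow (sq_nonneg t) (by linarith) (by positivity)
  refine (mul_le_mul_of_nonneg_right h1 (decay_pos t).le).trans_eq ?_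
  rw [decay, ← Real.rpow_add (by positivity)]
  congr 1
  ring

theorem integrable_abs_rpow_mul_decay {β : ℝ} (hβ : 0 ≤ β) (hβ' : β < 2) :
    Integrable fun t : ℝ => |t| ^ β * decay t := by
  refine (integrable_decay_rpow (r := 3 - β) (by linarith)).mono' ?_
    (Eventually.of_forall fun t => ?_)
  · exact ((Real.continuous_rpow_const hβ).comp continuous_abs).mul continuous_decay
      |>.aestronglyMeasurable
  · rw [Real.norm_of_nonneg (mul_nonneg (by positivity) (decay_pos t).le)]
    exact abs_rpow_mul_decay_le hβ t

/-- The measure `dσ dt` on `S¹ × ℝ`, with `S¹` parametrized by `θ ∈ (-π, π]`. -/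
def circleLine : Measure (ℝ × ℝ) :=
  (volume.restrict (Ioc (-Real.pi) Real.pi)).prod volume

instance : SFinite circleLine := by
  unfold circleLine
  infer_instance

/-- Almost everywhere on `S¹ × ℝ` both `p_σ` and `t` are different from `0`. -/
theorem ae_circleLine {P : ℝ × ℝ → Prop}
    (h : ∀ θ t : ℝ, |θ| ≤ Real.pi → θ ≠ 0 → t ≠ 0 → P (θ, t)) : ∀ᵐ q ∂circleLine, P q := by
  have h1 : ∀ᵐ θ ∂(volume.restrict (Ioc (-Real.pi) Real.pi)), |θ| ≤ Real.pi ∧ θ ≠ 0 := by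
    filter_upwards [ae_restrict_mem measurableSet_Ioc,
      ae_restrict_of_ae (Measure.ae_ne volume (0 : ℝ))] with θ hθ hθ'
    exact ⟨abs_le.mpr ⟨hθ.1.le, hθ.2⟩, hθ'⟩
  have h2 : ∀ᵐ t ∂(volume : Measure ℝ), t ≠ 0 := Measure.ae_ne volume 0
  have h3 : ∀ᵐ q ∂circleLine, |q.1| ≤ Real.pi ∧ q.1 ≠ 0 :=
    Measure.quasiMeasurePreserving_fst.ae h1
  have h4 : ∀ᵐ q ∂circleLine, q.2 ≠ 0 := Measure.quasiMeasurePreserving_snd.ae h2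
  filter_upwards [h3, h4] with q hq hq'
  exact h q.1 q.2 hq.1 hq.2 hq'

/-- The weight `t (1 + t²)^{-3/2} / p_σ`, odd in `t` and singular at `p_σ = 0`. -/
def singularWeight (q : ℝ × ℝ) : ℝ := 1 / chord q.1 * (q.2 * decay q.2)

theorem measurable_singularWeight : Measurable singularWeight := by
  have h1 := continuous_chord.measurable
  have h2 := continuous_decay.measurable
  unfold singularWeight
  fun_prop

theorem abs_singularWeight (q : ℝ × ℝ) :
    |singularWeight q| = 1 / chord q.1 * (|q.2| * decay q.2) := by
  rw [singularWeight, abs_mul, abs_mul, abs_of_nonneg (one_div_nonneg.mpr (chord_nonneg _)),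
    abs_of_pos (decay_pos _)]

/-- Negative powers of `p_σ` are comparable with those of `|θ|`; the constant is `(2 / π)⁻²`, from
`2 / π * |θ| ≤ p_σ` and `β ≥ -2`. -/
theorem chord_rpow_le {β : ℝ} (hβ : -2 ≤ β) (hβ' : β ≤ 0) {c θ : ℝ} (hc : 0 < c)
    (hθ : |θ| ≤ Real.pi) (h0 : θ ≠ 0) :
    (c * chord θ) ^ β ≤ (Real.pi / 2) ^ 2 * (c * |θ|) ^ β := by
  have hpi := Real.pi_pos
  have hθ' := abs_pos.mpr h0
  have h1 : 2 / Real.pi * (c * |θ|) ≤ c * chord θ := by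
    have := mul_le_mul_of_nonneg_left (mul_abs_le_chord hθ) hc.le
    linarith
  refine (Real.rpow_le_rpow_of_nonpos (by positivity) h1 hβ').trans ?_
  rw [Real.mul_rpow (by positivity) (by positivity)]
  refine mul_le_mul_of_nonneg_right ?_ (by positivity)
  have h2 : 2 / Real.pi ≤ 1 := div_le_one_of_le₀ Real.two_le_pi hpi.le
  refine (Real.rpow_le_rpow_of_exponent_ge (by positivity) h2 hβ).trans_eq ?_
  rw [Real.rpow_neg (by positivity), ← Real.inv_rpow (by positivity), inv_div]
  norm_num

/-- The basic majorant `|t| (1 + t²)^{-3/2} |t p_σ|^α / p_σ`. -/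
def majorant (α : ℝ≥0) (q : ℝ × ℝ) : ℝ := |singularWeight q| * |q.2 * chord q.1| ^ (α : ℝ)

theorem majorant_nonneg (q : ℝ × ℝ) : 0 ≤ majorant α q := by
  unfold majorant
  positivity

theorem integrable_abs_rpow_Ioc {β : ℝ} (hβ : -1 < β) :
    IntegrableOn (fun θ : ℝ => |θ| ^ β) (Ioc (-Real.pi) Real.pi) := by
  have hpi := Real.pi_pos
  have h1 : IntegrableOn (fun θ : ℝ => |θ| ^ β) (Ioc 0 Real.pi) := by
    refine (intervalIntegral.intervalIntegrable_rpow' hβ (a := 0) (b := Real.pi)).1.congr_fun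
      (fun θ hθ => ?_) measurableSet_Ioc
    simp only
    rw [abs_of_pos hθ.1]
  have h2 : IntervalIntegrable (fun θ : ℝ => |θ| ^ β) volume 0 Real.pi :=
    (intervalIntegrable_iff_integrableOn_Ioc_of_le hpi.le).mpr h1
  have h3 : IntervalIntegrable (fun θ : ℝ => |θ| ^ β) volume (-Real.pi) 0 := by
    have := h2.comp_sub_left 0
    simpa using this.symm
  exact (intervalIntegrable_iff_integrableOn_Ioc_of_le (by linarith)).mp (h3.trans h2)

theorem integrable_majorant (hα₀ : 0 < α) (hα₁ : α < 1) :
    Integrable (majorant α) circleLine := by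
  have ha : (0 : ℝ) < α := hα₀
  have ha' : (α : ℝ) < 1 := hα₁
  have h1 := ((integrable_abs_rpow_Ioc (β := α - 1) (by linarith)).const_mul
    ((Real.pi / 2) ^ 2)).mul_prod
    (integrable_abs_rpow_mul_decay (β := 1 + α) (by linarith) (by linarith))
  refine Integrable.mono' (μ := circleLine) h1 ?_ ?_
  · have h2 := continuous_chord.measurable
    have h3 := measurable_singularWeight
    have : Measurable (majorant α) := by
      unfold majorant
      fun_prop
    exact this.aestronglyMeasurable
  · refine ae_circleLine fun θ t hθ h0 ht => ?_
    rw [Real.norm_of_nonneg (majorant_nonneg _), majorant, abs_singularWeight]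
    simp only
    have hp := chord_pos hθ h0
    have h2 := chord_rpow_le (β := α - 1) (by linarith) (by linarith) one_pos hθ h0
    rw [one_mul, one_mul] at h2
    have e : 1 / chord θ * (|t| * decay t) * |t * chord θ| ^ (α : ℝ) =
        chord θ ^ ((α : ℝ) - 1) * (|t| ^ (1 + (α : ℝ)) * decay t) := by
      rw [abs_mul, abs_of_pos hp, Real.mul_rpow (abs_nonneg t) hp.le, Real.rpow_sub_one hp.ne',
        Real.rpow_one_add' (abs_nonneg t) (by positivity)]
      field_simp
    rw [e]
    exact mul_le_mul_of_nonneg_right h2 (mul_nonneg (by positivity) (decay_pos t).le)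

/-- The profile `min(u^α, u^{α-1})`. Up to the factor `h^α`, it bounds the contribution to an
increment of size `h` of the singular integral that comes from `|t p_σ| = u h`: the oscillations
themselves for `u ≤ 1`, the differences of averages for `u ≥ 1`. -/
def profile (α : ℝ≥0) (u : ℝ) : ℝ := min (u ^ (α : ℝ)) (u ^ ((α : ℝ) - 1))

theorem profile_of_le_one {u : ℝ} (hu : 0 < u) (h1 : u ≤ 1) :
    profile α u = u ^ (α : ℝ) :=
  min_eq_left (Real.rpow_le_rpow_of_exponent_ge hu h1 (by linarith))

theorem profile_of_one_le {u : ℝ} (h1 : 1 ≤ u) :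
    profile α u = u ^ ((α : ℝ) - 1) :=
  min_eq_right (Real.rpow_le_rpow_of_exponent_le h1 (by linarith))

/-- The function `min(|v|^{α-1}, |v|^{α-2})`, integrable both at `0` and at infinity. -/
def scaleProfile (α : ℝ≥0) (v : ℝ) : ℝ := min (|v| ^ ((α : ℝ) - 1)) (|v| ^ ((α : ℝ) - 2))

theorem scaleProfile_nonneg (v : ℝ) : 0 ≤ scaleProfile α v :=
  le_min (by positivity) (by positivity)

theorem measurable_scaleProfile : Measurable (scaleProfile α) := by
  unfold scaleProfile
  fun_prop

theorem integrable_scaleProfile (hα₀ : 0 < α) (hα₁ : α < 1) :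
    Integrable (scaleProfile α) := by
  have ha : (0 : ℝ) < α := hα₀
  have ha' : (α : ℝ) < 1 := hα₁
  have hIoi : IntegrableOn (scaleProfile α) (Ioi 0) := by
    rw [← Ioc_union_Ioi_eq_Ioi zero_le_one]
    refine IntegrableOn.union ?_ ?_
    · refine Integrable.mono'
        (intervalIntegral.intervalIntegrable_rpow' (r := (α : ℝ) - 1) (by linarith)
          (a := 0) (b := 1)).1 measurable_scaleProfile.aestronglyMeasurable ?_
      filter_upwards [ae_restrict_mem measurableSet_Ioc] with v hv
      rw [Real.norm_of_nonneg (scaleProfile_nonneg v)]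
      refine (min_le_left _ _).trans_eq ?_
      rw [abs_of_pos hv.1]
    · refine Integrable.mono' (integrableOn_Ioi_rpow_of_lt (a := (α : ℝ) - 2) (by linarith) one_pos)
        measurable_scaleProfile.aestronglyMeasurable ?_
      filter_upwards [ae_restrict_mem measurableSet_Ioi] with v hv
      rw [Real.norm_of_nonneg (scaleProfile_nonneg v)]
      refine (min_le_right _ _).trans_eq ?_
      rw [abs_of_pos (one_pos.trans hv)]
  have hIic : IntegrableOn (scaleProfile α) (Iic 0) := by
    rw [← Measure.map_neg_eq_self (volume : Measure ℝ)]
    let m : MeasurableEmbedding fun x : ℝ => -x := (Homeomorph.neg ℝ).measurableEmbedding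
    rw [m.integrableOn_map_iff]
    have e : scaleProfile α ∘ Neg.neg = scaleProfile α := by
      ext v
      simp [scaleProfile]
    change IntegrableOn (scaleProfile α ∘ Neg.neg) _ _
    rw [e, neg_preimage, neg_Iic, neg_zero]
    exact Iff.mpr integrableOn_Ici_iff_integrableOn_Ioi hIoi
  rw [← integrableOn_univ, ← Iic_union_Ioi (a := (0 : ℝ))]
  exact hIic.union hIoi

/-- The majorant `|t| (1 + t²)^{-3/2} min(u^α, u^{α-1}) / p_σ` with `u = |t p_σ| / h`. -/
def profileMajorant (α : ℝ≥0) (h : ℝ) (q : ℝ × ℝ) : ℝ :=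
  |singularWeight q| * profile α (|q.2 * chord q.1| / h)

theorem profile_nonneg {u : ℝ} (hu : 0 ≤ u) : 0 ≤ profile α u :=
  le_min (by positivity) (by positivity)

/-- A majorant of `profileMajorant` in which `p_σ` has been replaced by the comparable `|θ|`: up to
a factor that depends on `t` only, it is the function `v ↦ t / h · scaleProfile v` of `v = t θ / h`,
whose integral over `θ` does not depend on `t` and `h`. -/
def scaledMajorant (α : ℝ≥0) (h : ℝ) (q : ℝ × ℝ) : ℝ :=
  (Real.pi / 2) ^ 2 * ((|q.2| * decay q.2) * (|q.2| / h * scaleProfile α (q.2 / h * q.1)))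

theorem profileMajorant_le (hα₀ : 0 < α) (hα₁ : α < 1) {h : ℝ} (hh : 0 < h) {θ t : ℝ}
    (hθ : |θ| ≤ Real.pi) (h0 : θ ≠ 0) (ht : t ≠ 0) :
    profileMajorant α h (θ, t) ≤ scaledMajorant α h (θ, t) := by
  have ha : (0 : ℝ) < α := hα₀
  have ha' : (α : ℝ) < 1 := hα₁
  have hp := chord_pos hθ h0
  have ht' := abs_pos.mpr ht
  have hth : 0 < |t| / h := by positivity
  have hu : |t * chord θ| / h = |t| / h * chord θ := by
    rw [abs_mul, abs_of_pos hp]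
    ring
  have hv : |t / h * θ| = |t| / h * |θ| := by
    rw [abs_mul, abs_div, abs_of_pos hh]
  rw [profileMajorant, scaledMajorant, abs_singularWeight]
  simp only
  rw [hu, scaleProfile, hv]
  have hpos : 0 < |t| / h * chord θ := by positivity
  -- `profile u / u = min(u^{α-1}, u^{α-2})`, and `u` is comparable with `|t θ| / h`.
  have e : 1 / chord θ * profile α (|t| / h * chord θ) = |t| / h *
      min ((|t| / h * chord θ) ^ ((α : ℝ) - 1)) ((|t| / h * chord θ) ^ ((α : ℝ) - 2)) := by
    have e1 : (|t| / h * chord θ) ^ (α : ℝ) =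
        (|t| / h * chord θ) * (|t| / h * chord θ) ^ ((α : ℝ) - 1) := by
      rw [Real.rpow_sub_one hpos.ne']
      field_simp
    have e2 : (|t| / h * chord θ) ^ ((α : ℝ) - 1) =
        (|t| / h * chord θ) * (|t| / h * chord θ) ^ ((α : ℝ) - 2) := by
      rw [show (α : ℝ) - 2 = (α : ℝ) - 1 - 1 by ring, Real.rpow_sub_one hpos.ne' ((α : ℝ) - 1)]
      field_simp
    rw [profile]
    conv_lhs => rw [e1]
    conv_lhs => enter [2, 2]; rw [e2]
    rw [← mul_min_of_nonneg _ _ hpos.le]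
    field_simp
  have h1 := chord_rpow_le (β := (α : ℝ) - 1) (by linarith) (by linarith) hth hθ h0
  have h2 := chord_rpow_le (β := (α : ℝ) - 2) (by linarith) (by linarith) hth hθ h0
  have h3 := min_le_min h1 h2
  rw [← mul_min_of_nonneg _ _ (by positivity)] at h3
  have h4 : 0 ≤ |t| * decay t := mul_nonneg (abs_nonneg t) (decay_pos t).le
  calc 1 / chord θ * (|t| * decay t) * profile α (|t| / h * chord θ)
      = (|t| * decay t) * (1 / chord θ * profile α (|t| / h * chord θ)) := by ring
    _ ≤ (|t| * decay t) * (|t| / h * ((Real.pi / 2) ^ 2 *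
        min ((|t| / h * |θ|) ^ ((α : ℝ) - 1)) ((|t| / h * |θ|) ^ ((α : ℝ) - 2)))) := by
        rw [e]
        exact mul_le_mul_of_nonneg_left (mul_le_mul_of_nonneg_left h3 hth.le) h4
    _ = _ := by ring

theorem integral_scaleProfile_comp (t : ℝ) {h : ℝ} (hh : 0 < h) :
    ∫ θ, |t| * decay t * (|t| / h * scaleProfile α (t / h * θ)) =
      |t| * decay t * ∫ v, scaleProfile α v := by
  rw [integral_const_mul, integral_const_mul, Measure.integral_comp_mul_left, smul_eq_mul]
  rcases eq_or_ne t 0 with rfl | ht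
  · simp
  · have ht' := abs_pos.mpr ht
    rw [inv_div, abs_div, abs_of_pos hh]
    field_simp

/-- The constant in the bound for the integral of `profileMajorant`. -/
def profileConst (α : ℝ≥0) : ℝ :=
  (Real.pi / 2) ^ 2 * ((∫ t, |t| * decay t) * ∫ v, scaleProfile α v)

theorem integrable_scaledMajorant (hα₀ : 0 < α) (hα₁ : α < 1) {h : ℝ} (hh : 0 < h) :
    Integrable (scaledMajorant α h) (volume.prod volume) ∧
      ∫ q, scaledMajorant α h q ∂(volume.prod volume) = profileConst α := by
  have hd : Integrable fun t : ℝ => |t| * decay t := by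
    simpa using integrable_abs_rpow_mul_decay (β := 1) zero_le_one one_lt_two
  have hint : Integrable (fun q : ℝ × ℝ => (|q.2| * decay q.2) *
      (|q.2| / h * scaleProfile α (q.2 / h * q.1))) (volume.prod volume) := by
    have hm : Measurable (fun q : ℝ × ℝ => (|q.2| * decay q.2) *
      (|q.2| / h * scaleProfile α (q.2 / h * q.1))) := by
      have h1 := continuous_decay.measurable
      have h2 := measurable_scaleProfile (α := α)
      fun_prop
    rw [integrable_prod_iff' hm.aestronglyMeasurable]
    refine ⟨Eventually.of_forall fun t => ?_, ?_⟩
    · rcases eq_or_ne t 0 with rfl | ht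
      · simp
      · exact (((integrable_scaleProfile hα₀ hα₁).comp_mul_left'
          (div_ne_zero ht hh.ne')).const_mul (|t| / h)).const_mul (|t| * decay t)
    · have e : ∀ t : ℝ, ∫ θ, ‖|t| * decay t * (|t| / h * scaleProfile α (t / h * θ))‖ =
          |t| * decay t * ∫ v, scaleProfile α v := by
        intro t
        rw [← integral_scaleProfile_comp t hh]
        refine integral_congr_ae (Eventually.of_forall fun θ => Real.norm_of_nonneg ?_)
        have := scaleProfile_nonneg (α := α) (t / h * θ)
        have := (decay_pos t).le
        positivity
      simp only [e]
      exact hd.mul_const _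
  refine ⟨hint.const_mul _, ?_⟩
  unfold scaledMajorant
  rw [integral_const_mul, integral_prod_symm _ hint]
  simp only [integral_scaleProfile_comp _ hh]
  rw [integral_mul_const, profileConst]

theorem measurable_profileMajorant (h : ℝ) : Measurable (profileMajorant α h) := by
  have h2 := continuous_chord.measurable
  have h3 := measurable_singularWeight
  unfold profileMajorant profile
  fun_prop

/-- Scale invariance: the integral of `profileMajorant` is bounded uniformly in `h`. -/
theorem integrable_profileMajorant (hα₀ : 0 < α) (hα₁ : α < 1) {h : ℝ} (hh : 0 < h) :
    Integrable (profileMajorant α h) circleLine ∧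
      ∫ q, profileMajorant α h q ∂circleLine ≤ profileConst α := by
  obtain ⟨h1, h2⟩ := integrable_scaledMajorant hα₀ hα₁ hh
  have e : circleLine = ((volume : Measure ℝ).prod (volume : Measure ℝ)).restrict
      (Ioc (-Real.pi) Real.pi ×ˢ univ) := by
    rw [← Measure.prod_restrict, Measure.restrict_univ]
    rfl
  have h3 : Integrable (scaledMajorant α h) circleLine := by
    rw [e]
    exact h1.integrableOn
  have hae : ∀ᵐ q ∂circleLine, profileMajorant α h q ≤ scaledMajorant α h q :=
    ae_circleLine fun θ t hθ h0 ht => profileMajorant_le hα₀ hα₁ hh hθ h0 ht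
  have hnn : ∀ q, 0 ≤ profileMajorant α h q := fun q =>
    mul_nonneg (abs_nonneg _) (profile_nonneg (by positivity))
  have h4 : Integrable (profileMajorant α h) circleLine := by
    refine h3.mono' (measurable_profileMajorant h).aestronglyMeasurable ?_
    filter_upwards [hae] with q hq
    rwa [Real.norm_of_nonneg (hnn q)]
  refine ⟨h4, (integral_mono_ae h4 h3 hae).trans ?_⟩
  rw [← h2, e]
  refine setIntegral_le_integral h1 (Eventually.of_forall fun q => ?_)
  have := scaleProfile_nonneg (α := α) (q.2 / h * q.1)
  have := (decay_pos q.2).le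
  simp only [Pi.zero_apply, scaledMajorant]
  positivity

end

noncomputable section

open Filter Topology

variable {α : ℝ≥0}

/-! ### The regular integral operator -/

theorem continuous_of_holder {f : ℝ → ℝ} (hα₀ : 0 < α) {D : ℝ}
    (h : ∀ x y, |f x - f y| ≤ D * dist x y ^ (α : ℝ)) : Continuous f := by
  have ha : (0 : ℝ) < α := hα₀
  rw [continuous_iff_continuousAt]
  intro x
  rw [ContinuousAt, tendsto_iff_dist_tendsto_zero]
  have h0 : Tendsto (fun y => D * dist y x ^ (α : ℝ)) (𝓝 x) (𝓝 (D * dist x x ^ (α : ℝ))) := by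
    refine Continuous.tendsto ?_ x
    exact continuous_const.mul ((Real.continuous_rpow_const ha.le).comp (by fun_prop))
  rw [dist_self, Real.zero_rpow ha.ne', mul_zero] at h0
  exact squeeze_zero (fun _ => dist_nonneg) (fun y => h y x) h0

theorem abs_integral_le_of_abs_le {X : Type*} [MeasurableSpace X] {μ : Measure X} {f g : X → ℝ}
    (hg : Integrable g μ) (h : ∀ᵐ x ∂μ, |f x| ≤ g x) : |∫ x, f x ∂μ| ≤ ∫ x, g x ∂μ := by
  rw [← Real.norm_eq_abs]
  exact norm_integral_le_of_norm_le hg h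

/-- The argument `((s, t p_σ), |t|)` at which a kernel is evaluated under the integrals. -/
def kernelPoint (s : ℝ) (q : ℝ × ℝ) : (ℝ × ℝ) × ℝ := ((s, q.2 * chord q.1), |q.2|)

theorem measurable_kernelPoint (s : ℝ) : Measurable (kernelPoint s) := by
  have := continuous_chord.measurable
  unfold kernelPoint
  fun_prop

theorem abs_apply_sub_le (f : KernelAlgebra α) (s s' ξ τ : ℝ) :
    |f ((s, ξ), τ) - f ((s', ξ), τ)| ≤ ‖f‖ * dist s s' ^ (α : ℝ) := by
  have h := f.abs_sub_le (s, ξ) (s', ξ) τ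
  rwa [Prod.dist_eq, dist_self, max_eq_left dist_nonneg] at h

theorem abs_apply_sub_apply_zero_le (f : KernelAlgebra α) (s ξ τ : ℝ) :
    |f ((s, ξ), τ) - f ((s, 0), τ)| ≤ ‖f‖ * |ξ| ^ (α : ℝ) := by
  have h := f.abs_sub_le (s, ξ) (s, 0) τ
  rwa [Prod.dist_eq, dist_self, max_eq_right dist_nonneg, Real.dist_eq, sub_zero] at h

theorem integrable_decay_circleLine : Integrable (fun q : ℝ × ℝ => decay q.2) circleLine := by
  have h : Integrable (fun q : ℝ × ℝ => (1 : ℝ) * decay q.2) circleLine :=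
    (integrable_const (1 : ℝ)).mul_prod integrable_decay
  simpa using h

theorem measurable_regularIntegrand (b : KernelAlgebra α) (s : ℝ) :
    Measurable fun q : ℝ × ℝ => decay q.2 * b (kernelPoint s q) :=
  (continuous_decay.measurable.comp measurable_snd).mul
    (b.continuous.measurable.comp (measurable_kernelPoint s))

theorem integrable_regularIntegrand (b : KernelAlgebra α) (s : ℝ) :
    Integrable (fun q : ℝ × ℝ => decay q.2 * b (kernelPoint s q)) circleLine := by
  refine (integrable_decay_circleLine.mul_const ‖b‖).mono'
    (measurable_regularIntegrand b s).aestronglyMeasurable (Eventually.of_forall fun q => ?_)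
  rw [norm_mul, Real.norm_of_nonneg (decay_pos _).le]
  exact mul_le_mul_of_nonneg_left (b.abs_apply_le _) (decay_pos _).le

/-- The bounded linear map `b ↦ ∫_{S¹} ∫_ℝ (1 + t²)^{-3/2} b((s, t p_σ), |t|) dt dσ`. -/
def regularIntegral (hα₀ : 0 < α) : KernelAlgebra α →L[ℝ] HolderLine α :=
  have hhol : ∀ (b : KernelAlgebra α) (x x' : ℝ),
      |(∫ q, decay q.2 * b (kernelPoint x q) ∂circleLine) -
        ∫ q, decay q.2 * b (kernelPoint x' q) ∂circleLine| ≤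
        (∫ q : ℝ × ℝ, decay q.2 ∂circleLine) * ‖b‖ * dist x x' ^ (α : ℝ) := fun b x x' => by
    rw [← integral_sub (integrable_regularIntegrand b x) (integrable_regularIntegrand b x'),
      mul_assoc, ← integral_mul_const]
    refine abs_integral_le_of_abs_le (integrable_decay_circleLine.mul_const _)
      (Eventually.of_forall fun q => ?_)
    rw [← mul_sub, abs_mul, abs_of_pos (decay_pos _)]
    exact mul_le_mul_of_nonneg_left (abs_apply_sub_le b _ _ _ _) (decay_pos _).le
  HolderFamily.ofLinear
    { toFun := fun b x => ∫ q, decay q.2 * b (kernelPoint x.1 q) ∂circleLine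
      map_add' := fun b b' => by
        ext x
        simp only [HolderFamily.add_apply, mul_add, Pi.add_apply]
        exact integral_add (integrable_regularIntegrand b _) (integrable_regularIntegrand b' _)
      map_smul' := fun c b => by
        ext x
        simp only [HolderFamily.smul_apply, mul_left_comm _ c, integral_const_mul,
          Pi.smul_apply, smul_eq_mul, RingHom.id_apply] }
    (∫ q : ℝ × ℝ, decay q.2 ∂circleLine) (∫ q : ℝ × ℝ, decay q.2 ∂circleLine)
    (integral_nonneg fun q => (decay_pos _).le) (integral_nonneg fun q => (decay_pos _).le)
    (fun b => (continuous_of_holder hα₀ (hhol b)).comp continuous_fst)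
    (fun b x => by
      rw [← integral_mul_const]
      refine abs_integral_le_of_abs_le (integrable_decay_circleLine.mul_const _)
        (Eventually.of_forall fun q => ?_)
      rw [abs_mul, abs_of_pos (decay_pos _)]
      exact mul_le_mul_of_nonneg_left (b.abs_apply_le _) (decay_pos _).le)
    (fun b x x' _ => hhol b x x')

theorem hasDerivAt_regularIntegral (hα₀ : 0 < α) {b b' : KernelAlgebra α}
    (h : KernelAlgebra.HasSDeriv b b') (s : ℝ) :
    HasDerivAt (fun r => regularIntegral hα₀ b (r, ())) (regularIntegral hα₀ b' (s, ())) s := by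
  refine (hasDerivAt_integral_of_dominated_loc_of_deriv_le (s := univ)
    (F := fun r q => decay q.2 * b (kernelPoint r q))
    (F' := fun r q => decay q.2 * b' (kernelPoint r q))
    (bound := fun q => decay q.2 * ‖b'‖) univ_mem
    (Eventually.of_forall fun r => (measurable_regularIntegrand b r).aestronglyMeasurable)
    (integrable_regularIntegrand b s) (measurable_regularIntegrand b' s).aestronglyMeasurable
    (Eventually.of_forall fun q r _ => ?_) (integrable_decay_circleLine.mul_const _)
    (Eventually.of_forall fun q r _ => ?_)).2
  · rw [norm_mul, Real.norm_of_nonneg (decay_pos _).le]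
    exact mul_le_mul_of_nonneg_left (b'.abs_apply_le _) (decay_pos _).le
  · exact (h r _ _).const_mul _

/-! ### The singular integral functional -/

/-- The integrand `t (1 + t²)^{-3/2} / p_σ · (m((s, t p_σ), |t|) - m((s, 0), |t|))`. -/
def singularIntegrand (m : KernelAlgebra α) (s : ℝ) (q : ℝ × ℝ) : ℝ :=
  singularWeight q * (m (kernelPoint s q) - m ((s, 0), |q.2|))

theorem measurable_singularIntegrand (m : KernelAlgebra α) (s : ℝ) :
    Measurable (singularIntegrand m s) :=
  measurable_singularWeight.mul ((m.continuous.measurable.comp (measurable_kernelPoint s)).sub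
    (m.continuous.measurable.comp (by fun_prop)))

theorem abs_singularIntegrand_le (m : KernelAlgebra α) (s : ℝ) (q : ℝ × ℝ) :
    |singularIntegrand m s q| ≤ majorant α q * ‖m‖ := by
  rw [singularIntegrand, abs_mul, majorant, mul_assoc, mul_comm (_ ^ _) ‖m‖]
  exact mul_le_mul_of_nonneg_left (abs_apply_sub_apply_zero_le m _ _ _) (abs_nonneg _)

theorem integrable_singularIntegrand (hα₀ : 0 < α) (hα₁ : α < 1) (m : KernelAlgebra α) (s : ℝ) :
    Integrable (singularIntegrand m s) circleLine :=
  ((integrable_majorant hα₀ hα₁).mul_const ‖m‖).mono'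
    (measurable_singularIntegrand m s).aestronglyMeasurable
    (Eventually.of_forall (abs_singularIntegrand_le m s))

/-- The bounded linear functional that integrates `singularIntegrand` over `S¹ × ℝ`. -/
def singularFunctional (hα₀ : 0 < α) (hα₁ : α < 1) (s : ℝ) : KernelAlgebra α →L[ℝ] ℝ :=
  LinearMap.mkContinuous
    { toFun := fun m => ∫ q, singularIntegrand m s q ∂circleLine
      map_add' := fun m m' => by
        rw [← integral_add (integrable_singularIntegrand hα₀ hα₁ m s)
          (integrable_singularIntegrand hα₀ hα₁ m' s)]
        congr 1
        ext q
        simp only [singularIntegrand, HolderFamily.add_apply]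
        ring
      map_smul' := fun c m => by
        rw [RingHom.id_apply, smul_eq_mul, ← integral_const_mul]
        congr 1
        ext q
        simp only [singularIntegrand, HolderFamily.smul_apply]
        ring }
    (∫ q, majorant α q ∂circleLine) fun m => by
      rw [← integral_mul_const]
      exact abs_integral_le_of_abs_le ((integrable_majorant hα₀ hα₁).mul_const _)
        (Eventually.of_forall (abs_singularIntegrand_le m s))

theorem abs_singularFunctional_le (hα₀ : 0 < α) (hα₁ : α < 1) (s : ℝ) (m : KernelAlgebra α) :
    |singularFunctional hα₀ hα₁ s m| ≤ (∫ q, majorant α q ∂circleLine) * ‖m‖ := by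
  rw [← integral_mul_const]
  exact abs_integral_le_of_abs_le ((integrable_majorant hα₀ hα₁).mul_const _)
    (Eventually.of_forall (abs_singularIntegrand_le m s))

theorem hasDerivAt_singularFunctional (hα₀ : 0 < α) (hα₁ : α < 1) {m m' : KernelAlgebra α}
    (h : KernelAlgebra.HasSDeriv m m') (s : ℝ) :
    HasDerivAt (fun r => singularFunctional hα₀ hα₁ r m)
      (singularFunctional hα₀ hα₁ s m') s := by
  refine (hasDerivAt_integral_of_dominated_loc_of_deriv_le (s := univ)
    (F := fun r q => singularIntegrand m r q) (F' := fun r q => singularIntegrand m' r q)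
    (bound := fun q => majorant α q * ‖m'‖) univ_mem
    (Eventually.of_forall fun r => (measurable_singularIntegrand m r).aestronglyMeasurable)
    (integrable_singularIntegrand hα₀ hα₁ m s)
    (measurable_singularIntegrand m' s).aestronglyMeasurable
    (Eventually.of_forall fun q r _ => abs_singularIntegrand_le m' r q)
    ((integrable_majorant hα₀ hα₁).mul_const _)
    (Eventually.of_forall fun q r _ => ?_)).2
  exact ((h r _ _).sub (h r _ _)).const_mul _

/-! ### The Hölder estimate for the singular integral operator -/

namespace KernelAlgebra

variable {hα : α ≤ 1}

theorem abs_oscillation_le (g : HolderLine α) (s ξ τ : ℝ) :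
    |oscillation hα g ((s, ξ), τ)| ≤ ‖g‖ * |ξ| ^ (α : ℝ) := by
  have h := intervalIntegral.norm_integral_le_of_norm_le_const (a := (0 : ℝ)) (b := 1)
    (f := fun ρ => g (s - ρ * ξ, ()) - g (s, ())) (C := ‖g‖ * |ξ| ^ (α : ℝ)) fun ρ hρ => by
      rw [uIoc_of_le zero_le_one] at hρ
      refine (g.abs_sub_le _ _ _).trans (mul_le_mul_of_nonneg_left ?_ (norm_nonneg g))
      refine Real.rpow_le_rpow dist_nonneg ?_ α.2
      rw [Real.dist_eq, sub_sub_cancel_left, abs_neg, abs_mul, abs_of_pos hρ.1]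
      exact mul_le_of_le_one_left (abs_nonneg ξ) hρ.2
  rw [intervalIntegral.integral_sub ((continuous_segment g _ _).intervalIntegrable _ _)
    intervalIntegrable_const] at h
  rw [oscillation_apply]
  simpa using h

/-- The averages over `[s - ξ, s]` vary slowly with `s` for large `ξ`: their difference is the
difference of the integrals of `g` over `[s', s]` and `[s' - ξ, s - ξ]`, divided by `ξ`. -/
theorem abs_average_sub_le (g : HolderLine α) (s s' : ℝ) {ξ : ℝ} (hξ : ξ ≠ 0) (τ : ℝ) :
    |average hα g ((s, ξ), τ) - average hα g ((s', ξ), τ)| ≤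
      ‖g‖ * (|s - s'| * |ξ| ^ ((α : ℝ) - 1)) := by
  have hc : Continuous fun r => g (r, ()) := g.continuous.comp (by fun_prop)
  have hi : ∀ a b : ℝ, IntervalIntegrable (fun r => g (r, ())) volume a b := fun a b =>
    hc.intervalIntegrable a b
  have e : ∀ s, average hα g ((s, ξ), τ) = ξ⁻¹ * ∫ r in (s - ξ)..s, g (r, ()) := fun s => by
    rw [average_apply]
    have := intervalIntegral.integral_comp_sub_mul (a := (0 : ℝ)) (b := 1)
      (fun r => g (r, ())) hξ s
    simp only [mul_comm ξ, one_mul, zero_mul, sub_zero, smul_eq_mul] at this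
    exact this
  have hshift : ∫ r in (s' - ξ)..(s - ξ), g (r, ()) = ∫ r in s'..s, g (r - ξ, ()) :=
    (intervalIntegral.integral_comp_sub_right (fun r => g (r, ())) ξ).symm
  have hmain : (∫ r in (s - ξ)..s, g (r, ())) - ∫ r in (s' - ξ)..s', g (r, ()) =
      ∫ r in s'..s, (g (r, ()) - g (r - ξ, ())) := by
    have hi' : IntervalIntegrable (fun r => g (r - ξ, ())) volume s' s :=
      (hc.comp (by fun_prop : Continuous fun r : ℝ => r - ξ)).intervalIntegrable _ _
    rw [intervalIntegral.integral_sub (hi _ _) hi', ← hshift,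
      intervalIntegral.integral_interval_sub_interval_comm (hi _ _) (hi _ _) (hi _ _),
      intervalIntegral.integral_symm (s - ξ) (s' - ξ), intervalIntegral.integral_symm s s']
    ring
  have hb := intervalIntegral.norm_integral_le_of_norm_le_const (a := s') (b := s)
    (f := fun r => g (r, ()) - g (r - ξ, ())) (C := ‖g‖ * |ξ| ^ (α : ℝ)) fun r _ => by
      have := g.abs_sub_le r (r - ξ) ()
      rwa [Real.dist_eq, sub_sub_cancel] at this
  rw [e, e, ← mul_sub, hmain, abs_mul, abs_inv]
  have hξ' := abs_pos.mpr hξ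
  rw [Real.rpow_sub_one hξ'.ne', inv_mul_le_iff₀ hξ']
  refine hb.trans_eq ?_
  field_simp

/-- The correction of the difference of the integrands of the singular integral at two points: for
`|t p_σ| > |s - s'|` it cancels the constant `g(s) - g(s')` contained in the difference of the
oscillations. It is even in `t`, so its integral against the odd singular weight vanishes. -/
def evenPart (g : HolderLine α) (a : KernelAlgebra α) (s s' : ℝ) (q : ℝ × ℝ) : ℝ :=
  if |q.2 * chord q.1| ≤ |s - s'| then 0
  else (g (s, ()) - g (s', ())) * a ((s, 0), |q.2|)

theorem measurable_evenPart (g : HolderLine α) (a : KernelAlgebra α) (s s' : ℝ) :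
    Measurable (evenPart g a s s') := by
  refine Measurable.ite ?_ measurable_const
    (measurable_const.mul (a.continuous.measurable.comp (by fun_prop)))
  have := continuous_chord
  exact measurableSet_le (by fun_prop) measurable_const

theorem abs_evenPart_le (g : HolderLine α) (a : KernelAlgebra α) {s s' : ℝ} (h : s ≠ s')
    (q : ℝ × ℝ) : |singularWeight q * evenPart g a s s' q| ≤ majorant α q * (‖g‖ * ‖a‖) := by
  have hh : 0 < |s - s'| := abs_pos.mpr (sub_ne_zero.mpr h)
  rw [abs_mul, majorant, mul_assoc]
  refine mul_le_mul_of_nonneg_left ?_ (abs_nonneg _)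
  rw [evenPart]
  split_ifs with hq
  · rw [abs_zero]
    positivity
  · push Not at hq
    rw [abs_mul]
    have h1 := g.abs_sub_le s s' ()
    rw [Real.dist_eq] at h1
    have h2 : |s - s'| ^ (α : ℝ) ≤ |q.2 * chord q.1| ^ (α : ℝ) :=
      Real.rpow_le_rpow hh.le hq.le α.2
    calc |g (s, ()) - g (s', ())| * |a ((s, 0), |q.2|)|
        ≤ (‖g‖ * |q.2 * chord q.1| ^ (α : ℝ)) * ‖a‖ :=
          mul_le_mul (h1.trans (mul_le_mul_of_nonneg_left h2 (norm_nonneg g)))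
            (a.abs_apply_le _) (abs_nonneg _) (by positivity)
      _ = _ := by ring

theorem integral_evenPart (hα₀ : 0 < α) (hα₁ : α < 1) (g : HolderLine α) (a : KernelAlgebra α)
    {s s' : ℝ} (h : s ≠ s') :
    Integrable (fun q => singularWeight q * evenPart g a s s' q) circleLine ∧
      ∫ q, singularWeight q * evenPart g a s s' q ∂circleLine = 0 := by
  have hi : Integrable (fun q => singularWeight q * evenPart g a s s' q) circleLine :=
    ((integrable_majorant hα₀ hα₁).mul_const (‖g‖ * ‖a‖)).mono'
      (measurable_singularWeight.mul (measurable_evenPart g a s s')).aestronglyMeasurable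
      (Eventually.of_forall (abs_evenPart_le g a h))
  refine ⟨hi, ?_⟩
  have hz : ∀ θ, ∫ t, singularWeight (θ, t) * evenPart g a s s' (θ, t) = 0 := by
    intro θ
    have hodd : ∀ t, singularWeight (θ, -t) * evenPart g a s s' (θ, -t) =
        -(singularWeight (θ, t) * evenPart g a s s' (θ, t)) := by
      intro t
      simp only [singularWeight, evenPart, decay_neg, neg_mul, abs_neg]
      ring
    have h1 := integral_neg_eq_self
      (fun t => singularWeight (θ, t) * evenPart g a s s' (θ, t)) volume
    simp only [hodd, integral_neg] at h1
    linarith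
  rw [circleLine, integral_prod _ hi]
  simp only [hz, integral_zero]

/-- The pointwise estimate behind the Hölder bound for the singular integral. Near the singularity
both oscillations are small; far from it, they differ by a small difference of averages and by the
constant `g(s) - g(s')`, whose contribution is corrected by `evenPart`. -/
theorem abs_difference_le (g : HolderLine α) (a : KernelAlgebra α) {s s' : ℝ} (h : s ≠ s')
    {q : ℝ × ℝ} (hq : q.2 * chord q.1 ≠ 0) :
    |(oscillation hα g * a) (kernelPoint s q) - (oscillation hα g * a) (kernelPoint s' q) +
        evenPart g a s s' q| ≤
      2 * (‖g‖ * ‖a‖ * |s - s'| ^ (α : ℝ)) *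
        (profile α (|q.2 * chord q.1| / |s - s'|) + |q.2 * chord q.1| ^ (α : ℝ)) := by
  have hh : 0 < |s - s'| := abs_pos.mpr (sub_ne_zero.mpr h)
  simp only [kernelPoint, HolderFamily.mul_apply, evenPart]
  generalize q.2 * chord q.1 = ξ at hq ⊢
  generalize |q.2| = τ
  have hξ := abs_pos.mpr hq
  have hu : 0 < |ξ| / |s - s'| := by positivity
  have hscale : ∀ β : ℝ, |ξ| ^ β = |s - s'| ^ β * (|ξ| / |s - s'|) ^ β := fun β => by
    rw [← Real.mul_rpow hh.le hu.le, mul_div_cancel₀ _ hh.ne']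
  have hga : 0 ≤ ‖g‖ * ‖a‖ := by positivity
  have hsα : 0 ≤ |s - s'| ^ (α : ℝ) := by positivity
  have hξα : 0 ≤ |ξ| ^ (α : ℝ) := by positivity
  have hprod : ∀ r, |oscillation hα g ((r, ξ), τ) * a ((r, ξ), τ)| ≤
      ‖g‖ * ‖a‖ * |ξ| ^ (α : ℝ) := fun r => by
    rw [abs_mul]
    calc _ ≤ (‖g‖ * |ξ| ^ (α : ℝ)) * ‖a‖ := mul_le_mul (abs_oscillation_le g r ξ τ)
            (a.abs_apply_le _) (abs_nonneg _) (by positivity)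
      _ = _ := by ring
  split_ifs with hcase
  · have hp := profile_of_le_one (α := α) hu (div_le_one_of_le₀ hcase hh.le)
    have h1 := abs_sub (oscillation hα g ((s, ξ), τ) * a ((s, ξ), τ))
      (oscillation hα g ((s', ξ), τ) * a ((s', ξ), τ))
    rw [add_zero, hp]
    have h2 := hprod s
    have h3 := hprod s'
    have h4 := hscale α
    have h5 : 0 ≤ ‖g‖ * ‖a‖ * |s - s'| ^ (α : ℝ) * |ξ| ^ (α : ℝ) := by positivity
    calc _ ≤ 2 * (‖g‖ * ‖a‖ * |ξ| ^ (α : ℝ)) := by linarith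
      _ = 2 * (‖g‖ * ‖a‖ * |s - s'| ^ (α : ℝ)) * (|ξ| / |s - s'|) ^ (α : ℝ) := by
          rw [h4]; ring
      _ ≤ _ := by linarith
  · push Not at hcase
    have hp := profile_of_one_le (α := α) ((one_le_div hh).mpr hcase.le)
    rw [hp]
    have hosc : ∀ r, oscillation hα g ((r, ξ), τ) = average hα g ((r, ξ), τ) - g (r, ()) :=
      fun r => by rw [oscillation_apply, average_apply]
    have e : oscillation hα g ((s, ξ), τ) * a ((s, ξ), τ) -
        oscillation hα g ((s', ξ), τ) * a ((s', ξ), τ) +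
        (g (s, ()) - g (s', ())) * a ((s, 0), τ) =
        (average hα g ((s, ξ), τ) - average hα g ((s', ξ), τ)) * a ((s, ξ), τ) +
        oscillation hα g ((s', ξ), τ) * (a ((s, ξ), τ) - a ((s', ξ), τ)) -
        (g (s, ()) - g (s', ())) * (a ((s, ξ), τ) - a ((s, 0), τ)) := by
      rw [hosc, hosc]
      ring
    rw [e]
    have hA : |(average hα g ((s, ξ), τ) - average hα g ((s', ξ), τ)) * a ((s, ξ), τ)| ≤
        ‖g‖ * ‖a‖ * |s - s'| ^ (α : ℝ) * (|ξ| / |s - s'|) ^ ((α : ℝ) - 1) := by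
      rw [abs_mul]
      calc _ ≤ (‖g‖ * (|s - s'| * |ξ| ^ ((α : ℝ) - 1))) * ‖a‖ :=
            mul_le_mul (abs_average_sub_le g s s' hq τ) (a.abs_apply_le _) (abs_nonneg _)
              (by positivity)
        _ = _ := by
            rw [hscale ((α : ℝ) - 1), Real.rpow_sub_one hh.ne']
            field_simp
    have hB : |oscillation hα g ((s', ξ), τ) * (a ((s, ξ), τ) - a ((s', ξ), τ))| ≤
        ‖g‖ * ‖a‖ * |s - s'| ^ (α : ℝ) * |ξ| ^ (α : ℝ) := by
      rw [abs_mul]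
      have h1 := abs_apply_sub_le a s s' ξ τ
      rw [Real.dist_eq] at h1
      calc _ ≤ (‖g‖ * |ξ| ^ (α : ℝ)) * (‖a‖ * |s - s'| ^ (α : ℝ)) :=
            mul_le_mul (abs_oscillation_le g s' ξ τ) h1 (abs_nonneg _) (by positivity)
        _ = _ := by ring
    have hC : |(g (s, ()) - g (s', ())) * (a ((s, ξ), τ) - a ((s, 0), τ))| ≤
        ‖g‖ * ‖a‖ * |s - s'| ^ (α : ℝ) * |ξ| ^ (α : ℝ) := by
      rw [abs_mul]
      have h1 := g.abs_sub_le s s' ()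
      rw [Real.dist_eq] at h1
      calc _ ≤ (‖g‖ * |s - s'| ^ (α : ℝ)) * (‖a‖ * |ξ| ^ (α : ℝ)) :=
            mul_le_mul h1 (abs_apply_sub_apply_zero_le a s ξ τ) (abs_nonneg _) (by positivity)
        _ = _ := by ring
    have h1 := abs_sub ((average hα g ((s, ξ), τ) - average hα g ((s', ξ), τ)) * a ((s, ξ), τ) +
        oscillation hα g ((s', ξ), τ) * (a ((s, ξ), τ) - a ((s', ξ), τ)))
        ((g (s, ()) - g (s', ())) * (a ((s, ξ), τ) - a ((s, 0), τ)))
    have h2 := abs_add_le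
      ((average hα g ((s, ξ), τ) - average hα g ((s', ξ), τ)) * a ((s, ξ), τ))
      (oscillation hα g ((s', ξ), τ) * (a ((s, ξ), τ) - a ((s', ξ), τ)))
    have h3 : 0 ≤ ‖g‖ * ‖a‖ * |s - s'| ^ (α : ℝ) * (|ξ| / |s - s'|) ^ ((α : ℝ) - 1) := by
      positivity
    linarith

/-- The constant in the bounds for the singular integral operator. -/
def singularConst (α : ℝ≥0) : ℝ := profileConst α + ∫ q, majorant α q ∂circleLine

theorem abs_singularFunctional_sub_le (hα₀ : 0 < α) (hα₁ : α < 1) (g : HolderLine α)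
    (a : KernelAlgebra α) (s s' : ℝ) :
    |singularFunctional hα₀ hα₁ s (oscillation hα₁.le g * a) -
        singularFunctional hα₀ hα₁ s' (oscillation hα₁.le g * a)| ≤
      2 * singularConst α * (‖g‖ * ‖a‖) * dist s s' ^ (α : ℝ) := by
  have ha : (0 : ℝ) < α := hα₀
  rcases eq_or_ne s s' with rfl | h
  · rw [sub_self, abs_zero, dist_self, Real.zero_rpow ha.ne', mul_zero]
  have hh : 0 < |s - s'| := abs_pos.mpr (sub_ne_zero.mpr h)
  obtain ⟨hE, hE0⟩ := integral_evenPart hα₀ hα₁ g a h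
  obtain ⟨hP, hP1⟩ := integrable_profileMajorant hα₀ hα₁ hh
  have hM := integrable_majorant hα₀ hα₁
  have hF := integrable_singularIntegrand hα₀ hα₁ (oscillation hα₁.le g * a)
  have e : singularFunctional hα₀ hα₁ s (oscillation hα₁.le g * a) -
        singularFunctional hα₀ hα₁ s' (oscillation hα₁.le g * a) =
      ∫ q, (singularIntegrand (oscillation hα₁.le g * a) s q -
        singularIntegrand (oscillation hα₁.le g * a) s' q +
        singularWeight q * evenPart g a s s' q) ∂circleLine := by
    have h1 := integral_add ((hF s).sub (hF s')) hE
    rw [hE0, add_zero] at h1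
    exact ((integral_sub (hF s) (hF s')).symm.trans h1.symm)
  rw [e, Real.dist_eq]
  have hbound : ∫ q, 2 * (‖g‖ * ‖a‖ * |s - s'| ^ (α : ℝ)) *
      (profileMajorant α |s - s'| q + majorant α q) ∂circleLine ≤
      2 * singularConst α * (‖g‖ * ‖a‖) * |s - s'| ^ (α : ℝ) := by
    rw [integral_const_mul, integral_add hP hM, singularConst]
    have h0 : 0 ≤ 2 * (‖g‖ * ‖a‖ * |s - s'| ^ (α : ℝ)) := by positivity
    have := mul_le_mul_of_nonneg_left (add_le_add_left hP1 (∫ q, majorant α q ∂circleLine)) h0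
    linarith
  -- Adding the correction does not change the integral, and makes the integrand small.
  refine le_trans (abs_integral_le_of_abs_le ((hP.add hM).const_mul
    (2 * (‖g‖ * ‖a‖ * |s - s'| ^ (α : ℝ)))) ?_) hbound
  refine ae_circleLine fun θ t hθ h0 ht => ?_
  have hq : t * chord θ ≠ 0 := mul_ne_zero ht (chord_pos hθ h0).ne'
  have hz : ∀ r, (oscillation hα₁.le g * a) ((r, 0), |t|) = 0 := fun r => by
    rw [HolderFamily.mul_apply, oscillation_apply_zero, zero_mul]
  have h1 := mul_le_mul_of_nonneg_left
    (abs_difference_le (hα := hα₁.le) g a h (q := (θ, t)) hq) (abs_nonneg (singularWeight (θ, t)))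
  rw [← abs_mul] at h1
  simp only [singularIntegrand, hz, sub_zero]
  rw [← mul_sub, ← mul_add]
  refine h1.trans_eq ?_
  simp only [Pi.add_apply, profileMajorant, majorant]
  ring

end KernelAlgebra

open KernelAlgebra in
/-- The singular integral operator
`S(g, a)(s) = ∫_{S¹} ∫_ℝ t (1 + t²)^{-3/2} / p_σ · (∫₀¹ (g(s - ρ t p_σ) - g(s)) dρ) ·
a((s, t p_σ), |t|) dt dσ`. -/
def singularOperator (hα₀ : 0 < α) (hα₁ : α < 1) (g : HolderLine α) (a : KernelAlgebra α) :
    HolderLine α :=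
  HolderFamily.mk (fun x => singularFunctional hα₀ hα₁ x.1 (oscillation hα₁.le g * a))
    ((continuous_of_holder hα₀ (abs_singularFunctional_sub_le hα₀ hα₁ g a)).comp continuous_fst)
    ((∫ q, majorant α q ∂circleLine) * ‖oscillation hα₁.le g * a‖)
    (2 * |singularConst α| * (‖g‖ * ‖a‖)) (by positivity)
    (fun x => abs_singularFunctional_le hα₀ hα₁ _ _)
    (fun x x' _ => (abs_singularFunctional_sub_le hα₀ hα₁ g a x x').trans (by
      gcongr
      exact le_abs_self _))

open KernelAlgebra in
theorem singularOperator_apply (hα₀ : 0 < α) (hα₁ : α < 1) (g : HolderLine α)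
    (a : KernelAlgebra α) (x : ℝ × Unit) : singularOperator hα₀ hα₁ g a x =
      singularFunctional hα₀ hα₁ x.1 (oscillation hα₁.le g * a) := rfl

open KernelAlgebra in
theorem isBoundedBilinearMap_singularOperator (hα₀ : 0 < α) (hα₁ : α < 1) :
    IsBoundedBilinearMap ℝ
      fun p : HolderLine α × KernelAlgebra α => singularOperator hα₀ hα₁ p.1 p.2 where
  add_left g g' a := by
    ext x y
    simp only [singularOperator_apply, HolderFamily.add_apply, map_add, add_mul]
  smul_left c g a := by
    ext x y
    simp only [singularOperator_apply, HolderFamily.smul_apply, map_smul, smul_mul_assoc,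
      smul_eq_mul]
  add_right g a a' := by
    ext x y
    simp only [singularOperator_apply, HolderFamily.add_apply, map_add, mul_add]
  smul_right c g a := by
    ext x y
    simp only [singularOperator_apply, HolderFamily.smul_apply, map_smul, mul_smul_comm,
      smul_eq_mul]
  bound := by
    have hM : 0 ≤ ∫ q, majorant α q ∂circleLine := integral_nonneg fun q => majorant_nonneg q
    refine ⟨(∫ q, majorant α q ∂circleLine) * ‖oscillation hα₁.le‖ +
      2 * |singularConst α| + 1, by positivity, fun g a => ?_⟩
    have h1 : ‖oscillation hα₁.le g * a‖ ≤ ‖oscillation hα₁.le‖ * ‖g‖ * ‖a‖ :=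
      (norm_mul_le _ _).trans
        (mul_le_mul_of_nonneg_right ((oscillation hα₁.le).le_opNorm g) (norm_nonneg a))
    have h2 : ‖singularOperator hα₀ hα₁ g a‖ ≤
        (∫ q, majorant α q ∂circleLine) * ‖oscillation hα₁.le g * a‖ +
          2 * |singularConst α| * (‖g‖ * ‖a‖) :=
      HolderFamily.norm_le (by positivity) (by positivity)
        (fun x => abs_singularFunctional_le hα₀ hα₁ _ _)
        (fun x x' _ => (abs_singularFunctional_sub_le hα₀ hα₁ g a x x').trans (by
          gcongr
          exact le_abs_self _))
    have h3 := mul_le_mul_of_nonneg_left h1 hM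
    have h4 : 0 ≤ ‖g‖ * ‖a‖ := by positivity
    linarith

end

noncomputable section

open Filter Topology

variable {α : ℝ≥0}

/-! ### The resolvent of the derivative -/

namespace HolderLine

theorem continuous_apply (h : HolderLine α) : Continuous fun s => h (s, ()) :=
  h.continuous.comp (by fun_prop)

theorem continuous_exp_mul (h : HolderLine α) : Continuous fun r => Real.exp (-r) * h (r, ()) :=
  (by fun_prop : Continuous fun r : ℝ => Real.exp (-r)).mul h.continuous_apply

theorem integrableOn_exp_mul (h : HolderLine α) (s : ℝ) :
    IntegrableOn (fun r => Real.exp (-r) * h (r, ())) (Ioi s) := by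
  refine Integrable.mono' ((integrableOn_exp_neg_Ioi s).mul_const ‖h‖)
    h.continuous_exp_mul.aestronglyMeasurable (Eventually.of_forall fun r => ?_)
  rw [norm_mul, Real.norm_of_nonneg (Real.exp_pos _).le]
  exact mul_le_mul_of_nonneg_left (h.abs_apply_le _) (Real.exp_pos _).le

/-- The function `u(s) = eˢ ∫_s^∞ e^{-r} h(r) dr`, the bounded solution of `u - u' = h`. -/
def resolventFun (h : HolderLine α) (s : ℝ) : ℝ :=
  Real.exp s * ∫ r in Ioi s, Real.exp (-r) * h (r, ())

theorem abs_resolventFun_le (h : HolderLine α) (s : ℝ) : |resolventFun h s| ≤ ‖h‖ := by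
  have h1 : |∫ r in Ioi s, Real.exp (-r) * h (r, ())| ≤ Real.exp (-s) * ‖h‖ := by
    rw [← integral_exp_neg_Ioi, ← integral_mul_const]
    refine abs_integral_le_of_abs_le ((integrableOn_exp_neg_Ioi s).mul_const ‖h‖)
      (Eventually.of_forall fun r => ?_)
    rw [abs_mul, abs_of_pos (Real.exp_pos _)]
    exact mul_le_mul_of_nonneg_left (h.abs_apply_le _) (Real.exp_pos _).le
  rw [resolventFun, abs_mul, abs_of_pos (Real.exp_pos s)]
  refine (mul_le_mul_of_nonneg_left h1 (Real.exp_pos s).le).trans_eq ?_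
  rw [← mul_assoc, ← Real.exp_add, add_neg_cancel, Real.exp_zero, one_mul]

theorem hasDerivAt_resolventFun (h : HolderLine α) (s : ℝ) :
    HasDerivAt (resolventFun h) (resolventFun h s - h (s, ())) s := by
  have e : ∀ s, ∫ r in Ioi s, Real.exp (-r) * h (r, ()) =
      (∫ r in Ioi 0, Real.exp (-r) * h (r, ())) -
        ∫ r in (0 : ℝ)..s, Real.exp (-r) * h (r, ()) := fun s => by
    rw [← intervalIntegral.integral_Ioi_sub_Ioi' (h.integrableOn_exp_mul 0)
      (h.integrableOn_exp_mul s), sub_sub_cancel]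
  have h1 := intervalIntegral.integral_hasDerivAt_right
    (h.continuous_exp_mul.intervalIntegrable 0 s)
    (h.continuous_exp_mul.stronglyMeasurableAtFilter _ _) h.continuous_exp_mul.continuousAt
  have h2 := (Real.hasDerivAt_exp s).mul (h1.const_sub
    (∫ r in Ioi 0, Real.exp (-r) * h (r, ())))
  have h3 : resolventFun h = fun s => Real.exp s * ((∫ r in Ioi 0, Real.exp (-r) * h (r, ())) -
        ∫ r in (0 : ℝ)..s, Real.exp (-r) * h (r, ())) := funext fun s => by
    rw [resolventFun, e]
  rw [h3]
  refine h2.congr_deriv ?_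
  have h4 : Real.exp s * Real.exp (-s) = 1 := by rw [← Real.exp_add, add_neg_cancel, Real.exp_zero]
  linear_combination (-h (s, ())) * h4

theorem continuous_resolventFun (h : HolderLine α) : Continuous (resolventFun h) :=
  continuous_iff_continuousAt.mpr fun s => (hasDerivAt_resolventFun h s).continuousAt

theorem iteratedDeriv_one_resolventFun (h : HolderLine α) :
    iteratedDeriv 1 (resolventFun h) = fun s => resolventFun h s - h (s, ()) := by
  rw [iteratedDeriv_one]
  exact funext fun s => (hasDerivAt_resolventFun h s).deriv

theorem abs_deriv_resolventFun_le (h : HolderLine α) (s : ℝ) :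
    |resolventFun h s - h (s, ())| ≤ 2 * ‖h‖ := by
  have := abs_sub (resolventFun h s) (h (s, ()))
  linarith [abs_resolventFun_le h s, h.abs_apply_le (s, ())]

theorem abs_deriv_resolventFun_sub_le (hα : α ≤ 1) (h : HolderLine α) (s s' : ℝ) :
    |(resolventFun h s - h (s, ())) - (resolventFun h s' - h (s', ()))| ≤
      5 * ‖h‖ * dist s s' ^ (α : ℝ) := by
  have h1 := HolderSpace.holder_of_lipschitz (f := resolventFun h) hα (norm_nonneg h)
    (by positivity : 0 ≤ 2 * ‖h‖) (abs_resolventFun_le h) (fun x y => by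
      have := convex_univ.norm_image_sub_le_of_norm_hasDerivWithin_le
          (fun z _ => (hasDerivAt_resolventFun h z).hasDerivWithinAt)
          (fun z _ => abs_deriv_resolventFun_le h z) (mem_univ y) (mem_univ x)
      rwa [Real.norm_eq_abs, ← dist_eq_norm] at this) s s'
  have h2 := h.abs_sub_le s s' ()
  rw [show (resolventFun h s - h (s, ())) - (resolventFun h s' - h (s', ())) =
    (resolventFun h s - resolventFun h s') - (h (s, ()) - h (s', ())) by ring]
  refine (abs_sub _ _).trans ?_
  linarith

theorem holderWith_deriv_resolventFun (hα : α ≤ 1) (h : HolderLine α) :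
    HolderWith (5 * ‖h‖₊) α (iteratedDeriv 1 (resolventFun h)) := by
  rw [iteratedDeriv_one_resolventFun]
  intro s s'
  rw [edist_dist, edist_dist, ← ENNReal.ofReal_coe_nnreal,
    ENNReal.ofReal_rpow_of_nonneg dist_nonneg (NNReal.coe_nonneg α), ← ENNReal.ofReal_mul (by positivity),
    Real.dist_eq]
  refine ENNReal.ofReal_le_ofReal ?_
  exact (abs_deriv_resolventFun_sub_le hα h s s')

theorem resolventFun_mem (hα : α ≤ 1) (h : HolderLine α) :
    resolventFun h ∈ holderSubmodule 1 α := by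
  refine ⟨?_, fun i hi => ?_, ⟨_, holderWith_deriv_resolventFun hα h⟩⟩
  · refine contDiff_one_iff_deriv.mpr
      ⟨fun s => (hasDerivAt_resolventFun h s).differentiableAt, ?_⟩
    rw [← iteratedDeriv_one, iteratedDeriv_one_resolventFun]
    exact (continuous_resolventFun h).sub h.continuous_apply
  · refine ⟨2 * ‖h‖, ?_⟩
    rintro _ ⟨s, rfl⟩
    interval_cases i
    · simp only [iteratedDeriv_zero]
      linarith [abs_resolventFun_le h s, norm_nonneg h]
    · rw [iteratedDeriv_one_resolventFun]
      exact abs_deriv_resolventFun_le h s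

/-- The bounded linear map `(1 - d/ds)⁻¹` from `C^{0,α}(ℝ)` to `C^{1,α}(ℝ)`. -/
def resolvent (hα : α ≤ 1) : HolderLine α →L[ℝ] HolderSpace 1 α :=
  LinearMap.mkContinuous
    { toFun := fun h => ⟨resolventFun h, resolventFun_mem hα h⟩
      map_add' := fun h h' => by
        refine Subtype.ext (funext fun s => ?_)
        change resolventFun (h + h') s = resolventFun h s + resolventFun h' s
        simp only [resolventFun, HolderFamily.add_apply, mul_add]
        rw [integral_add (h.integrableOn_exp_mul s) (h'.integrableOn_exp_mul s), mul_add]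
      map_smul' := fun c h => by
        refine Subtype.ext (funext fun s => ?_)
        change resolventFun (c • h) s = c * resolventFun h s
        simp only [resolventFun, HolderFamily.smul_apply, mul_left_comm _ c, integral_const_mul] }
    8 fun h => by
      rw [HolderSpace.norm_def, Finset.sum_range_succ, Finset.sum_range_one]
      have h0 : (⨆ x, |iteratedDeriv 0 (resolventFun h) x|) ≤ ‖h‖ :=
        Real.iSup_le (fun x => by simpa using abs_resolventFun_le h x) (norm_nonneg h)
      have h1 : (⨆ x, |iteratedDeriv 1 (resolventFun h) x|) ≤ 2 * ‖h‖ := by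
        rw [iteratedDeriv_one_resolventFun]
        exact Real.iSup_le (abs_deriv_resolventFun_le h) (by positivity)
      have h2 : (nnHolderNorm α (iteratedDeriv 1 (resolventFun h)) : ℝ) ≤ 5 * ‖h‖ := by
        exact_mod_cast (holderWith_deriv_resolventFun hα h).nnholderNorm_le
      exact (add_le_add (add_le_add h0 h1) h2).trans_eq (by ring)

theorem resolvent_apply (hα : α ≤ 1) (h : HolderLine α) (s : ℝ) :
    resolvent hα h s = resolventFun h s := rfl

/-- The resolvent recovers a function `f₀` with derivative `f₁` from `f₀ - f₁`. -/
theorem resolvent_sub (hα : α ≤ 1) {f₀ f₁ : HolderLine α}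
    (h : ∀ s, HasDerivAt (fun r => f₀ (r, ())) (f₁ (s, ())) s) (s : ℝ) :
    resolvent hα (f₀ - f₁) s = f₀ (s, ()) := by
  -- The difference `w` is a bounded solution of `w' = w`, hence vanishes.
  set w : ℝ → ℝ := fun r => resolventFun (f₀ - f₁) r - f₀ (r, ()) with hw
  have hw' : ∀ r, HasDerivAt w (w r) r := fun r => by
    refine ((hasDerivAt_resolventFun (f₀ - f₁) r).sub (h r)).congr_deriv ?_
    rw [hw, HolderFamily.sub_apply]
    ring
  have hc : ∀ r, HasDerivAt (fun r => Real.exp (-r) * w r) 0 r := fun r => by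
    refine (((hasDerivAt_neg r).exp).mul (hw' r)).congr_deriv ?_
    ring
  have hconst : ∀ r, Real.exp (-r) * w r = Real.exp (-s) * w s := fun r =>
    is_const_of_deriv_eq_zero (fun r => (hc r).differentiableAt) (fun r => (hc r).deriv) r s
  have hb : ∀ r, |w r| ≤ ‖f₀ - f₁‖ + ‖f₀‖ := fun r =>
    (abs_sub _ _).trans (add_le_add (abs_resolventFun_le _ r) (f₀.abs_apply_le _))
  have hlim : Tendsto (fun r => Real.exp (-r) * w r) atTop (𝓝 0) := by
    refine squeeze_zero_norm (a := fun r => Real.exp (-r) * (‖f₀ - f₁‖ + ‖f₀‖)) (fun r => ?_) ?_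
    · rw [norm_mul, Real.norm_of_nonneg (Real.exp_pos _).le]
      exact mul_le_mul_of_nonneg_left (hb r) (Real.exp_pos _).le
    · simpa using (Real.tendsto_exp_neg_atTop_nhds_zero).mul_const (‖f₀ - f₁‖ + ‖f₀‖)
  have hzero : Real.exp (-s) * w s = 0 := by
    simp only [hconst] at hlim
    exact tendsto_nhds_unique tendsto_const_nhds hlim
  have : w s = 0 := (mul_eq_zero.mp hzero).resolve_left (Real.exp_pos _).ne'
  rw [resolvent_apply]
  exact sub_eq_zero.mp this

end HolderLine

end

noncomputable section

open Filter Topology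

variable {α : ℝ≥0}

/-! ### The kernels as smooth maps into the kernel algebra -/

open KernelAlgebra HolderSpace HolderFamily

theorem hasDerivAt_jet {j : ℕ} (hα : α ≤ 1) {i : ℕ} (hi : i + 1 ≤ j) (φ : HolderSpace j α)
    (s : ℝ) :
    HasDerivAt (fun r => jet hα i (Nat.le_of_succ_le hi) φ (r, ())) (jet hα (i + 1) hi φ (s, ()))
      s :=
  φ.hasDerivAt_iteratedDeriv hi s

variable (hα : α ≤ 1)

/-- The kernel `φ(s)`. -/
def baseValue : HolderSpace 2 α →L[ℝ] KernelAlgebra α :=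
  translate hα 0 ∘L jet hα 0 zero_le_two

/-- The kernel `φ(s - ξ)`. -/
def shiftedValue : HolderSpace 2 α →L[ℝ] KernelAlgebra α :=
  translate hα 1 ∘L jet hα 0 zero_le_two

/-- The kernel `φ'(s - ξ)`. -/
def shiftedDeriv : HolderSpace 2 α →L[ℝ] KernelAlgebra α :=
  translate hα 1 ∘L jet hα 1 one_le_two

/-- The kernel `Λ₀(φ, s, ξ)`. -/
def slope : HolderSpace 2 α →L[ℝ] KernelAlgebra α :=
  average hα ∘L jet hα 1 one_le_two

/-- The kernel `Λ₁(φ, s, ξ)`. -/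
def slopeDefect : HolderSpace 2 α →L[ℝ] KernelAlgebra α :=
  oscillation hα ∘L jet hα 1 one_le_two

theorem baseValue_apply (φ : HolderSpace 2 α) (s ξ τ : ℝ) :
    baseValue hα φ ((s, ξ), τ) = φ s := by
  simp [baseValue]

theorem shiftedValue_apply (φ : HolderSpace 2 α) (s ξ τ : ℝ) :
    shiftedValue hα φ ((s, ξ), τ) = φ (s - ξ) := by
  simp [shiftedValue]

theorem shiftedDeriv_apply (φ : HolderSpace 2 α) (s ξ τ : ℝ) :
    shiftedDeriv hα φ ((s, ξ), τ) = deriv φ (s - ξ) := by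
  simp [shiftedDeriv, iteratedDeriv_one]

theorem slope_apply (φ : HolderSpace 2 α) (s ξ τ : ℝ) :
    slope hα φ ((s, ξ), τ) = lambda0 φ s ξ := by
  simp [slope, lambda0, iteratedDeriv_one]

theorem slopeDefect_apply (φ : HolderSpace 2 α) (s ξ τ : ℝ) :
    slopeDefect hα φ ((s, ξ), τ) = lambda1 φ s ξ := by
  rw [slopeDefect, ContinuousLinearMap.comp_apply, oscillation_apply]
  simp [lambda1, lambda0, iteratedDeriv_one]

/-- The kernel `(τ² (1 + Λ₀²) + φ(s) φ(s - ξ)) / (1 + τ²)`, the normalized radicand of `𝒦`. -/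
def radicand (φ : HolderSpace 2 α) : KernelAlgebra α :=
  (1 - weight α) * (1 + slope hα φ * slope hα φ) +
    weight α * (baseValue hα φ * shiftedValue hα φ)

/-- The kernel `φ(s - ξ) √(1 + φ'(s - ξ)²)`. -/
def areaFactor (φ : HolderSpace 2 α) : KernelAlgebra α :=
  shiftedValue hα φ * (1 + shiftedDeriv hα φ * shiftedDeriv hα φ).sqrt

/-- The kernel `(1 + τ²)^{3/2} 𝒦`. -/
def normalizedKernel (φ : HolderSpace 2 α) : KernelAlgebra α :=
  areaFactor hα φ *
    ((radicand hα φ).sqrt * ((radicand hα φ).sqrt * (radicand hα φ).sqrt)).inv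

theorem lt_apply_of_mem_aboveSet {δ : ℝ} {φ : HolderSpace 2 α} (hφ : φ ∈ aboveSet α δ) (s : ℝ) :
    δ < φ s := by
  refine lt_of_lt_of_le hφ (ciInf_le ⟨-‖φ‖, ?_⟩ s)
  rintro _ ⟨x, rfl⟩
  exact (abs_le.mp (φ.abs_apply_le x)).1

theorem isOpen_aboveSet (δ : ℝ) : IsOpen (aboveSet α δ) := by
  rw [Metric.isOpen_iff]
  intro φ hφ
  have hφ' : δ < ⨅ s, φ s := hφ
  refine ⟨((⨅ s, φ s) - δ) / 2, by linarith, fun ψ hψ => ?_⟩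
  rw [Metric.mem_ball, dist_eq_norm] at hψ
  refine lt_of_lt_of_le (b := ((⨅ s, φ s) + δ) / 2) (by linarith) (le_ciInf fun s => ?_)
  have h1 : (⨅ s, φ s) ≤ φ s := by
    refine ciInf_le ⟨-‖φ‖, ?_⟩ s
    rintro _ ⟨x, rfl⟩
    exact (abs_le.mp (φ.abs_apply_le x)).1
  have h2 : |ψ s - φ s| ≤ ‖ψ - φ‖ := (ψ - φ).abs_apply_le s
  linarith [(abs_le.mp h2).1]

theorem radicand_apply (φ : HolderSpace 2 α) (s ξ t : ℝ) :
    (1 + t ^ 2) * radicand hα φ ((s, ξ), |t|) =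
      t ^ 2 + t ^ 2 * lambda0 φ s ξ ^ 2 + φ s * φ (s - ξ) := by
  have h : (1 : ℝ) + t ^ 2 ≠ 0 := by positivity
  simp only [radicand, HolderFamily.add_apply, mul_apply, HolderFamily.sub_apply, one_apply, weight_apply, slope_apply,
    baseValue_apply, shiftedValue_apply, sq_abs]
  field_simp
  ring

theorem radicand_mem_positive {δ : ℝ} (hδ : 0 < δ) {φ : HolderSpace 2 α}
    (hφ : φ ∈ aboveSet α δ) : radicand hα φ ∈ positive (ℝ × ℝ) ℝ α := by
  refine ⟨min 1 (δ * δ), lt_min one_pos (mul_pos hδ hδ), fun q => ?_⟩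
  obtain ⟨⟨s, ξ⟩, τ⟩ := q
  have h1 := lt_apply_of_mem_aboveSet hφ s
  have h2 := lt_apply_of_mem_aboveSet hφ (s - ξ)
  have h3 : δ * δ ≤ φ s * φ (s - ξ) := mul_le_mul h1.le h2.le hδ.le (hδ.trans h1).le
  have h4 : (0 : ℝ) < 1 / (1 + τ ^ 2) := by positivity
  have h5 : 1 / (1 + τ ^ 2) ≤ 1 := div_le_one_of_le₀ (by nlinarith [sq_nonneg τ]) (by positivity)
  simp only [radicand, HolderFamily.add_apply, mul_apply, HolderFamily.sub_apply, one_apply, weight_apply, slope_apply,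
    baseValue_apply, shiftedValue_apply]
  have h6 : min 1 (δ * δ) ≤ 1 + lambda0 φ s ξ * lambda0 φ s ξ :=
    (min_le_left _ _).trans (by nlinarith [mul_self_nonneg (lambda0 φ s ξ)])
  have h7 : min 1 (δ * δ) ≤ φ s * φ (s - ξ) := (min_le_right _ _).trans h3
  nlinarith [mul_le_mul_of_nonneg_left h6 (sub_nonneg.mpr h5), mul_le_mul_of_nonneg_left h7 h4.le]

theorem one_add_sq_mem_positive (f : KernelAlgebra α) : 1 + f * f ∈ positive (ℝ × ℝ) ℝ α :=
  ⟨1, one_pos, fun q => by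
    rw [HolderFamily.add_apply, one_apply, mul_apply]
    nlinarith [mul_self_nonneg (f q)]⟩

theorem mul_mem_positive {X Y : Type} [MetricSpace X] [TopologicalSpace Y]
    {f g : HolderFamily X Y α} (hf : f ∈ positive X Y α) (hg : g ∈ positive X Y α) :
    f * g ∈ positive X Y α := by
  obtain ⟨c, hc, h⟩ := hf
  obtain ⟨d, hd, h'⟩ := hg
  exact ⟨c * d, mul_pos hc hd, fun q => mul_le_mul (h q) (h' q) hd.le (hc.le.trans (h q))⟩

theorem sqrt_cube_mem_positive {f : KernelAlgebra α} (hf : f ∈ positive (ℝ × ℝ) ℝ α) :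
    f.sqrt * (f.sqrt * f.sqrt) ∈ positive (ℝ × ℝ) ℝ α :=
  mul_mem_positive (sqrt_mem_positive hf)
    (mul_mem_positive (sqrt_mem_positive hf) (sqrt_mem_positive hf))

theorem hasSDeriv_const_kernel {f : KernelAlgebra α}
    (h : ∀ s s' ξ τ, f ((s, ξ), τ) = f ((s', ξ), τ)) :
    HasSDeriv f 0 := fun s ξ τ => by
  have e : (fun r => f ((r, ξ), τ)) = fun _ => f ((s, ξ), τ) := funext fun r => h r s ξ τ
  rw [e]
  exact hasDerivAt_const s _

theorem smoothWithSDeriv_shiftedValue (U : Set (HolderSpace 2 α)) :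
    SmoothWithSDeriv U (shiftedValue hα) :=
  SmoothWithSDeriv.clm (L' := translate hα 1 ∘L jet hα 1 one_le_two) fun φ =>
    hasSDeriv_translate hα 1 (hasDerivAt_jet hα one_le_two φ)

theorem smoothWithSDeriv_normalizedKernel {δ : ℝ} (hδ : 0 < δ) :
    SmoothWithSDeriv (aboveSet α δ) (normalizedKernel hα) := by
  have hone : SmoothWithSDeriv (aboveSet α δ) fun _ => (1 : KernelAlgebra α) :=
    .const (hasSDeriv_const_kernel fun _ _ _ _ => rfl)
  have hw : SmoothWithSDeriv (aboveSet α δ) fun _ => weight α :=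
    .const (hasSDeriv_const_kernel fun _ _ _ _ => rfl)
  have hw' : SmoothWithSDeriv (aboveSet α δ) fun _ => 1 - weight α :=
    .const (hasSDeriv_const_kernel fun _ _ _ _ => rfl)
  have hv := smoothWithSDeriv_shiftedValue hα (aboveSet α δ)
  have hb : SmoothWithSDeriv (aboveSet α δ) (baseValue hα) :=
    SmoothWithSDeriv.clm (L' := translate hα 0 ∘L jet hα 1 one_le_two) fun φ =>
      hasSDeriv_translate hα 0 (hasDerivAt_jet hα one_le_two φ)
  have hd : SmoothWithSDeriv (aboveSet α δ) (shiftedDeriv hα) :=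
    SmoothWithSDeriv.clm (L' := translate hα 1 ∘L jet hα 2 le_rfl) fun φ =>
      hasSDeriv_translate hα 1 (hasDerivAt_jet hα le_rfl φ)
  have hs : SmoothWithSDeriv (aboveSet α δ) (slope hα) :=
    SmoothWithSDeriv.clm (L' := average hα ∘L jet hα 2 le_rfl) fun φ =>
      hasSDeriv_average hα (hasDerivAt_jet hα le_rfl φ)
  have hr : SmoothWithSDeriv (aboveSet α δ) (radicand hα) :=
    (hw'.mul (hone.add (hs.mul hs))).add (hw.mul (hb.mul hv))
  have hrs := hr.sqrt fun φ hφ => radicand_mem_positive hα hδ hφ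
  exact (hv.mul ((hone.add (hd.mul hd)).sqrt fun φ _ => one_add_sq_mem_positive _)).mul
    ((hrs.mul (hrs.mul hrs)).inv fun φ hφ =>
      sqrt_cube_mem_positive (radicand_mem_positive hα hδ hφ))

theorem kernelK_eq {δ : ℝ} (hδ : 0 < δ) {φ : HolderSpace 2 α} (hφ : φ ∈ aboveSet α δ)
    (s t ξ : ℝ) :
    kernelK φ s t ξ = decay t * normalizedKernel hα φ ((s, ξ), |t|) := by
  have hp := radicand_mem_positive hα hδ hφ
  have hE := pos_of_mem_positive hp ((s, ξ), |t|)
  have h32 : ∀ x : ℝ, 0 ≤ x → x ^ (3 / 2 : ℝ) = √x * (√x * √x) := fun x hx => by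
    rw [Real.mul_self_sqrt hx, show (3 / 2 : ℝ) = 1 / 2 + 1 by norm_num,
      Real.rpow_add_one' hx (by norm_num), Real.sqrt_eq_rpow]
  rw [kernelK, ← radicand_apply hα, Real.mul_rpow (by positivity) hE.le, normalizedKernel,
    mul_apply, inv_apply (sqrt_cube_mem_positive hp), mul_apply, mul_apply, sqrt_apply hp,
    ← h32 _ hE.le, areaFactor, mul_apply, sqrt_apply (one_add_sq_mem_positive _), HolderFamily.add_apply,
    one_apply, mul_apply, shiftedDeriv_apply, shiftedValue_apply, decay,
    Real.rpow_neg (by positivity), ← sq, div_eq_mul_inv, mul_inv]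
  ring

/-- The kernel `(1 + τ²)^{3/2} Λ₁ 𝒦`; its values vanish for `ξ = 0`. -/
def singularKernel (φ : HolderSpace 2 α) : KernelAlgebra α :=
  slopeDefect hα φ * normalizedKernel hα φ

/-- The kernel `(1 + τ²)^{3/2} φ(s - ξ) 𝒦`. -/
def regularKernel (φ : HolderSpace 2 α) : KernelAlgebra α :=
  shiftedValue hα φ * normalizedKernel hα φ

theorem singularKernel_apply_zero (φ : HolderSpace 2 α) (s τ : ℝ) :
    singularKernel hα φ ((s, 0), τ) = 0 := by
  rw [singularKernel, mul_apply, slopeDefect, ContinuousLinearMap.comp_apply,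
    oscillation_apply_zero, zero_mul]

theorem contDiffOn_singularKernel {δ : ℝ} (hδ : 0 < δ) :
    ContDiffOn ℝ ∞ (singularKernel hα) (aboveSet α δ) :=
  (slopeDefect hα).contDiff.contDiffOn.mul (smoothWithSDeriv_normalizedKernel hα hδ).1

theorem contDiffOn_regularKernel {δ : ℝ} (hδ : 0 < δ) :
    ContDiffOn ℝ ∞ (regularKernel hα) (aboveSet α δ) :=
  (shiftedValue hα).contDiff.contDiffOn.mul (smoothWithSDeriv_normalizedKernel hα hδ).1

theorem kernelM_eq {δ : ℝ} (hδ : 0 < δ) {φ : HolderSpace 2 α} (hφ : φ ∈ aboveSet α δ)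
    (s t p : ℝ) :
    kernelM φ s t p = t * decay t * singularKernel hα φ ((s, t * p), |t|) := by
  rw [kernelM, kernelK_eq hα hδ hφ, singularKernel, mul_apply, slopeDefect_apply]
  ring

theorem kernelMbar_eq {δ : ℝ} (hδ : 0 < δ) {φ : HolderSpace 2 α} (hφ : φ ∈ aboveSet α δ)
    (s t p : ℝ) :
    kernelMbar φ s t p = decay t * regularKernel hα φ ((s, t * p), |t|) := by
  rw [kernelMbar, kernelK_eq hα hδ hφ, regularKernel, mul_apply, shiftedValue_apply]
  ring

/-! ### The smooth operator -/

/-- The operator `φ ↦ ∫∫ ℳ / p_σ + ½ ∫∫ ℳ̄` is smooth from `C^{2,α}` to `C^{1,α}`. Its values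
and their derivatives in `s` are given by `singularOperator` and `regularIntegral`, applied to smooth
maps, and the resolvent turns this pair into an element of `C^{1,α}`. -/
theorem exists_smooth_operator (hα₀ : 0 < α) (hα₁ : α < 1) {δ : ℝ} (hδ : 0 < δ) :
    ∃ T : HolderSpace 2 α → HolderSpace 1 α, ContDiffOn ℝ ∞ T (aboveSet α δ) ∧
      ∀ φ ∈ aboveSet α δ, ∀ s,
        T φ s = singularFunctional hα₀ hα₁ s (singularKernel hα₁.le φ) +
          1 / 2 * regularIntegral hα₀ (regularKernel hα₁.le φ) (s, ()) := by
  obtain ⟨ha, a', ha', hda⟩ := smoothWithSDeriv_normalizedKernel hα₁.le hδ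
  obtain ⟨hb, b', hb', hdb⟩ := (smoothWithSDeriv_shiftedValue hα₁.le (aboveSet α δ)).mul
    (smoothWithSDeriv_normalizedKernel hα₁.le hδ)
  have hS := (isBoundedBilinearMap_singularOperator hα₀ hα₁).contDiff (n := ∞)
  have hj : ∀ i (hi : i ≤ 2), ContDiffOn ℝ ∞ (jet hα₁.le i hi) (aboveSet α δ) := fun i hi =>
    (jet hα₁.le i hi).contDiff.contDiffOn
  have hI := (regularIntegral hα₀ (α := α)).contDiff (n := ∞)
  -- `T₀` is the operator with values in `C^{0,α}`, and `T₁` its derivative in `s`.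
  set T₀ : HolderSpace 2 α → HolderLine α := fun φ =>
    singularOperator hα₀ hα₁ (jet hα₁.le 1 one_le_two φ) (normalizedKernel hα₁.le φ) +
      (1 / 2 : ℝ) • regularIntegral hα₀ (regularKernel hα₁.le φ) with hT₀
  set T₁ : HolderSpace 2 α → HolderLine α := fun φ =>
    singularOperator hα₀ hα₁ (jet hα₁.le 2 le_rfl φ) (normalizedKernel hα₁.le φ) +
      singularOperator hα₀ hα₁ (jet hα₁.le 1 one_le_two φ) (a' φ) +
      (1 / 2 : ℝ) • regularIntegral hα₀ (b' φ) with hT₁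
  have hc₀ : ContDiffOn ℝ ∞ T₀ (aboveSet α δ) :=
    (hS.comp_contDiffOn ((hj 1 one_le_two).prodMk ha)).add
      ((hI.comp_contDiffOn hb).const_smul (1 / 2 : ℝ))
  have hc₁ : ContDiffOn ℝ ∞ T₁ (aboveSet α δ) :=
    ((hS.comp_contDiffOn ((hj 2 le_rfl).prodMk ha)).add
      (hS.comp_contDiffOn ((hj 1 one_le_two).prodMk ha'))).add
      ((hI.comp_contDiffOn hb').const_smul (1 / 2 : ℝ))
  refine ⟨fun φ => HolderLine.resolvent hα₁.le (T₀ φ - T₁ φ),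
    (HolderLine.resolvent hα₁.le).contDiff.comp_contDiffOn (hc₀.sub hc₁), fun φ hφ s => ?_⟩
  have hderiv : ∀ s, HasDerivAt (fun r => T₀ φ (r, ())) (T₁ φ (s, ())) s := by
    intro s
    have h1 := hasDerivAt_singularFunctional hα₀ hα₁ ((hasSDeriv_oscillation hα₁.le
      (hasDerivAt_jet hα₁.le le_rfl φ)).mul (hda φ hφ)) s
    rw [map_add] at h1
    exact h1.add ((hasDerivAt_regularIntegral hα₀ (hdb φ hφ) s).const_mul (1 / 2))
  exact HolderLine.resolvent_sub hα₁.le hderiv s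

/-! ### The derivative formula -/

theorem circleLineIntegral_eq {f : ℝ → ℝ → ℝ} (hf : CircleLineIntegrable f) :
    circleLineIntegral f = ∫ q, f q.1 q.2 ∂circleLine :=
  (integral_prod _ hf).symm

/-- A continuous linear map commutes with the iterated derivatives of a map, even if the
composition is only known near the point. -/
theorem iteratedFDeriv_eq_of_eventuallyEq {W E F : Type*} [NormedAddCommGroup W] [NormedSpace ℝ W]
    [NormedAddCommGroup E] [NormedSpace ℝ E] [NormedAddCommGroup F] [NormedSpace ℝ F]
    {f : W → E} {g : W → F} (L : E →L[ℝ] F) {φ : W} (hf : ContDiffAt ℝ ∞ f φ)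
    (h : g =ᶠ[𝓝 φ] fun ψ => L (f ψ)) (k : ℕ) (v : Fin k → W) :
    iteratedFDeriv ℝ k g φ v = L (iteratedFDeriv ℝ k f φ v) := by
  rw [(h.iteratedFDeriv ℝ k).eq_of_nhds]
  have := L.iteratedFDeriv_comp_left hf (i := k) (by exact_mod_cast le_top)
  exact congrArg (fun M => M v) this

/-- Evaluation at a point of `ℝ`. -/
def HolderSpace.evalAt {j : ℕ} (s : ℝ) : HolderSpace j α →L[ℝ] ℝ :=
  LinearMap.mkContinuous
    { toFun := fun u => u s, map_add' := fun _ _ => rfl, map_smul' := fun _ _ => rfl } 1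
    fun u => by
      rw [one_mul]
      exact u.abs_apply_le s

/-- The derivative formula on the domain of a bounded linear map `ι` into `C^{2,α}`. All functions
of `φ` involved are continuous linear images of the two kernels as maps into the kernel algebra, so
their iterated derivatives are the images of the iterated derivatives of those. -/
theorem derivative_formula (hα₀ : 0 < α) (hα₁ : α < 1) {δ : ℝ} (hδ : 0 < δ)
    {T : HolderSpace 2 α → HolderSpace 1 α} (hT : ContDiffOn ℝ ∞ T (aboveSet α δ))
    (hTf : ∀ φ ∈ aboveSet α δ, ∀ s,
        T φ s = singularFunctional hα₀ hα₁ s (singularKernel hα₁.le φ) +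
          1 / 2 * regularIntegral hα₀ (regularKernel hα₁.le φ) (s, ()))
    {W : Type*} [NormedAddCommGroup W] [NormedSpace ℝ W] (ι : W →L[ℝ] HolderSpace 2 α) {φ : W}
    (hφ : ι φ ∈ aboveSet α δ) (k : ℕ) (v : Fin k → W) (s : ℝ) :
    CircleLineIntegrable (fun θ t => 1 / chord θ * iteratedFDeriv ℝ k
        (fun ψ : W => kernelM (ι ψ) s t (chord θ)) φ v) ∧
      CircleLineIntegrable (fun θ t => iteratedFDeriv ℝ k
        (fun ψ : W => kernelMbar (ι ψ) s t (chord θ)) φ v) ∧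
      iteratedFDeriv ℝ k (fun ψ : W => T (ι ψ)) φ v s =
        circleLineIntegral (fun θ t => 1 / chord θ * iteratedFDeriv ℝ k
          (fun ψ : W => kernelM (ι ψ) s t (chord θ)) φ v) +
        1 / 2 * circleLineIntegral (fun θ t => iteratedFDeriv ℝ k
          (fun ψ : W => kernelMbar (ι ψ) s t (chord θ)) φ v) := by
  have hnhds : aboveSet α δ ∈ 𝓝 (ι φ) := (isOpen_aboveSet δ).mem_nhds hφ
  have hev : ∀ᶠ ψ in 𝓝 φ, ι ψ ∈ aboveSet α δ := ι.continuous.continuousAt hnhds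
  have hm : ContDiffAt ℝ ∞ (fun ψ => singularKernel hα₁.le (ι ψ)) φ :=
    ((contDiffOn_singularKernel hα₁.le hδ).contDiffAt hnhds).comp φ ι.contDiff.contDiffAt
  have hb : ContDiffAt ℝ ∞ (fun ψ => regularKernel hα₁.le (ι ψ)) φ :=
    ((contDiffOn_regularKernel hα₁.le hδ).contDiffAt hnhds).comp φ ι.contDiff.contDiffAt
  have hT' : ContDiffAt ℝ ∞ (fun ψ => T (ι ψ)) φ :=
    (hT.contDiffAt hnhds).comp φ ι.contDiff.contDiffAt
  set m := iteratedFDeriv ℝ k (fun ψ => singularKernel hα₁.le (ι ψ)) φ v with hmdef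
  set b := iteratedFDeriv ℝ k (fun ψ => regularKernel hα₁.le (ι ψ)) φ v with hbdef
  have hM : ∀ t p, iteratedFDeriv ℝ k (fun ψ : W => kernelM (ι ψ) s t p) φ v =
      t * decay t * m ((s, t * p), |t|) := fun t p =>
    iteratedFDeriv_eq_of_eventuallyEq ((t * decay t) • eval ((s, t * p), |t|)) hm
      (hev.mono fun ψ hψ => kernelM_eq hα₁.le hδ hψ s t p) k v
  have hMbar : ∀ t p, iteratedFDeriv ℝ k (fun ψ : W => kernelMbar (ι ψ) s t p) φ v =
      decay t * b ((s, t * p), |t|) := fun t p =>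
    iteratedFDeriv_eq_of_eventuallyEq (decay t • eval ((s, t * p), |t|)) hb
      (hev.mono fun ψ hψ => kernelMbar_eq hα₁.le hδ hψ s t p) k v
  have hm0 : ∀ τ, m ((s, 0), τ) = 0 := fun τ => by
    have h1 := iteratedFDeriv_eq_of_eventuallyEq (g := fun _ : W => (0 : ℝ)) (eval ((s, 0), τ)) hm
      (Eventually.of_forall fun ψ => (singularKernel_apply_zero hα₁.le (ι ψ) s τ).symm) k v
    rw [iteratedFDeriv_fun_zero] at h1
    exact h1.symm
  have e1 : (fun q : ℝ × ℝ => 1 / chord q.1 * iteratedFDeriv ℝ k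
      (fun ψ : W => kernelM (ι ψ) s q.2 (chord q.1)) φ v) = singularIntegrand m s := by
    ext q
    rw [hM, singularIntegrand, hm0, sub_zero, singularWeight, kernelPoint]
    ring
  have e2 : (fun q : ℝ × ℝ => iteratedFDeriv ℝ k
      (fun ψ : W => kernelMbar (ι ψ) s q.2 (chord q.1)) φ v) =
      fun q => decay q.2 * b (kernelPoint s q) := by
    ext q
    rw [hMbar, kernelPoint]
  have i1 : CircleLineIntegrable (fun θ t => 1 / chord θ * iteratedFDeriv ℝ k
        (fun ψ : W => kernelM (ι ψ) s t (chord θ)) φ v) := by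
    have := integrable_singularIntegrand hα₀ hα₁ m s
    rw [← e1] at this
    exact this
  have i2 : CircleLineIntegrable (fun θ t => iteratedFDeriv ℝ k
        (fun ψ : W => kernelMbar (ι ψ) s t (chord θ)) φ v) := by
    have := integrable_regularIntegrand b s
    rw [← e2] at this
    exact this
  refine ⟨i1, i2, ?_⟩
  rw [circleLineIntegral_eq i1, circleLineIntegral_eq i2, e1, e2]
  have h1 := iteratedFDeriv_eq_of_eventuallyEq (HolderSpace.evalAt s) hT'
    (EventuallyEq.refl _ _) k v
  have h2 := iteratedFDeriv_eq_of_eventuallyEq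
    (g := fun ψ => HolderSpace.evalAt s (T (ι ψ)))
    ((singularFunctional hα₀ hα₁ s).coprod ((1 / 2 : ℝ) • (eval (s, ()) ∘L regularIntegral hα₀)))
    (hm.prodMk hb) (hev.mono fun ψ hψ => hTf _ hψ s) k v
  have h3 := iteratedFDeriv_eq_of_eventuallyEq (g := fun ψ => singularKernel hα₁.le (ι ψ))
    (ContinuousLinearMap.fst ℝ (KernelAlgebra α) (KernelAlgebra α))
    (hm.prodMk hb) (EventuallyEq.refl _ _) k v
  have h4 := iteratedFDeriv_eq_of_eventuallyEq (g := fun ψ => regularKernel hα₁.le (ι ψ))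
    (ContinuousLinearMap.snd ℝ (KernelAlgebra α) (KernelAlgebra α))
    (hm.prodMk hb) (EventuallyEq.refl _ _) k v
  rw [h2] at h1
  refine h1.symm.trans ?_
  rw [ContinuousLinearMap.coprod_apply]
  rw [ContinuousLinearMap.coe_fst'] at h3
  rw [ContinuousLinearMap.coe_snd'] at h4
  rw [← h3, ← h4]
  rfl

end

noncomputable section

open Filter Topology

variable {α : ℝ≥0}

/-! ### The surface integral in the coordinates `(σ, t)` -/

theorem hasDerivAt_vec3 {f g h : ℝ → ℝ} {f' g' h' x : ℝ} (hf : HasDerivAt f f' x)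
    (hg : HasDerivAt g g' x) (hh : HasDerivAt h h' x) :
    HasDerivAt (fun r => (!₂[f r, g r, h r] : EuclideanSpace ℝ (Fin 3))) !₂[f', g', h'] x := by
  have h1 : HasDerivAt (fun r => ![f r, g r, h r]) ![f', g', h'] x := by
    rw [hasDerivAt_pi]
    intro i
    fin_cases i
    · exact hf
    · exact hg
    · exact hh
  exact (PiLp.continuousLinearEquiv 2 ℝ (fun _ : Fin 3 => ℝ)).symm.hasFDerivAt.comp_hasDerivAt x h1

theorem areaElement_eq {φ : ℝ → ℝ} (hφ : Differentiable ℝ φ) (r θ : ℝ) :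
    areaElement φ r θ = |φ r| * √(1 + deriv φ r ^ 2) := by
  have h1 : deriv (fun x => surfaceMap φ x θ) r =
      !₂[deriv φ r * Real.cos θ, deriv φ r * Real.sin θ, 1] :=
    (hasDerivAt_vec3 ((hφ r).hasDerivAt.mul_const _) ((hφ r).hasDerivAt.mul_const _)
      (hasDerivAt_id r)).deriv
  have h2 : deriv (fun τ => surfaceMap φ r τ) θ =
      !₂[φ r * -Real.sin θ, φ r * Real.cos θ, 0] :=
    (hasDerivAt_vec3 ((Real.hasDerivAt_cos θ).const_mul _) ((Real.hasDerivAt_sin θ).const_mul _)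
      (hasDerivAt_const θ r)).deriv
  have hcs := Real.sin_sq_add_cos_sq θ
  rw [areaElement, h1, h2, EuclideanSpace.real_norm_sq_eq, EuclideanSpace.real_norm_sq_eq,
    PiLp.inner_apply, Fin.sum_univ_three, Fin.sum_univ_three, Fin.sum_univ_three]
  simp only [Matrix.cons_val_zero, Matrix.cons_val_one, Matrix.cons_val, RCLike.inner_apply, conj_trivial]
  rw [← Real.sqrt_sq_eq_abs, ← Real.sqrt_mul (sq_nonneg _)]
  congr 1
  linear_combination (φ r ^ 2 * deriv φ r ^ 2 * (Real.sin θ ^ 2 + Real.cos θ ^ 2) +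
    φ r ^ 2 * deriv φ r ^ 2 + φ r ^ 2) * hcs

theorem fieldIntegrand_surfaceMap (φ : ℝ → ℝ) (s r θ : ℝ) :
    fieldIntegrand φ s (surfaceMap φ r θ) =
      (1 / √(1 + deriv φ s ^ 2)) * (φ r * Real.cos θ - φ s - deriv φ s * (r - s)) /
        √((s - r) ^ 2 + (φ s - φ r) ^ 2 + φ s * φ r * chord θ ^ 2) ^ 3 := by
  have hcs := Real.sin_sq_add_cos_sq θ
  rw [fieldIntegrand, unitNormal, inner_smul_right, surfaceMap, surfaceMap, PiLp.inner_apply,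
    EuclideanSpace.norm_eq, Fin.sum_univ_three, Fin.sum_univ_three, chord_sq]
  simp only [PiLp.sub_apply, Matrix.cons_val_zero, Matrix.cons_val_one,
    Matrix.cons_val, RCLike.inner_apply, conj_trivial, Real.norm_eq_abs,
    sq_abs, Real.cos_zero, Real.sin_zero]
  congr 2
  · ring
  · congr 1
    linear_combination (φ r ^ 2) * hcs

theorem mul_lambda0 {φ : ℝ → ℝ} (hφ : ContDiff ℝ 1 φ) (s ξ : ℝ) :
    ξ * lambda0 φ s ξ = φ s - φ (s - ξ) := by
  have h := intervalIntegral.mul_integral_comp_sub_mul (f := deriv φ) (a := (0 : ℝ)) (b := 1) ξ s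
  simp only [mul_one, mul_zero, sub_zero] at h
  rw [lambda0]
  simp only [mul_comm _ ξ]
  rw [h]
  exact intervalIntegral.integral_deriv_eq_sub (fun x _ => hφ.differentiable one_ne_zero x)
    ((hφ.continuous_deriv le_rfl).intervalIntegrable _ _)

/-- In the coordinates `r = s - t p_σ`, the surface integrand becomes the sum of the two kernels. -/
theorem kernel_decomposition {φ : ℝ → ℝ} (hφ : ContDiff ℝ 1 φ) (hpos : ∀ x, 0 < φ x) (s t : ℝ)
    {θ : ℝ} (hp : 0 < chord θ) :
    chord θ * (-√(1 + deriv φ s ^ 2) * (areaElement φ (s - t * chord θ) θ *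
      fieldIntegrand φ s (surfaceMap φ (s - t * chord θ) θ))) =
    1 / chord θ * kernelM φ s t (chord θ) + 1 / 2 * kernelMbar φ s t (chord θ) := by
  have hΛ := mul_lambda0 hφ s (t * chord θ)
  have hcos : Real.cos θ = 1 - chord θ ^ 2 / 2 := by rw [chord_sq]; ring
  rw [areaElement_eq (hφ.differentiable one_ne_zero), fieldIntegrand_surfaceMap, kernelM,
    kernelMbar, kernelK, lambda1, hcos, abs_of_pos (hpos _)]
  have h1 := hpos s
  have h2 := hpos (s - t * chord θ)
  generalize φ (s - t * chord θ) = ψ at *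
  generalize √(1 + deriv φ (s - t * chord θ) ^ 2) = w
  generalize lambda0 φ s (t * chord θ) = l at *
  generalize chord θ = p at *
  have hD : 0 < t ^ 2 + t ^ 2 * l ^ 2 + φ s * ψ := by positivity
  have hnorm : (s - (s - t * p)) ^ 2 + (φ s - ψ) ^ 2 + φ s * ψ * p ^ 2 =
      p ^ 2 * (t ^ 2 + t ^ 2 * l ^ 2 + φ s * ψ) := by
    rw [← hΛ]
    ring
  have h32 : (t ^ 2 + t ^ 2 * l ^ 2 + φ s * ψ) ^ (3 / 2 : ℝ) =
      √(t ^ 2 + t ^ 2 * l ^ 2 + φ s * ψ) ^ 3 := by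
    rw [Real.sqrt_eq_rpow, ← Real.rpow_mul_natCast hD.le]
    norm_num
  rw [hnorm, Real.sqrt_mul (sq_nonneg p), Real.sqrt_sq hp.le, h32]
  have hS := Real.sqrt_pos.mpr hD
  generalize √(t ^ 2 + t ^ 2 * l ^ 2 + φ s * ψ) = D at *
  have hW : 0 < √(1 + deriv φ s ^ 2) := Real.sqrt_pos.mpr (by positivity)
  generalize √(1 + deriv φ s ^ 2) = W at *
  have hnum : ψ * (1 - p ^ 2 / 2) - φ s - deriv φ s * (s - t * p - s) =
      -(p * (t * (l - deriv φ s) + ψ * p / 2)) := by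
    linear_combination hΛ
  rw [hnum]
  field_simp

/-- The substitution `r = s - t p_σ` on each line, for integrands on `ℝ × S¹`. -/
theorem integral_comp_line {G : ℝ × ℝ → ℝ} (hG : Measurable G) (s : ℝ)
    (hI : Integrable (fun q => chord q.1 * G (s - q.2 * chord q.1, q.1)) circleLine) :
    Integrable G (volume.prod (volume.restrict (Ioc (-Real.pi) Real.pi))) ∧
      ∫ q, G q ∂(volume.prod (volume.restrict (Ioc (-Real.pi) Real.pi))) =
        ∫ q, chord q.1 * G (s - q.2 * chord q.1, q.1) ∂circleLine := by
  have hchord : ∀ᵐ θ ∂(volume.restrict (Ioc (-Real.pi) Real.pi)), 0 < chord θ := by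
    filter_upwards [ae_restrict_mem measurableSet_Ioc,
      ae_restrict_of_ae (Measure.ae_ne volume (0 : ℝ))] with θ hθ hθ'
    exact chord_pos (abs_le.mpr ⟨hθ.1.le, hθ.2⟩) hθ'
  have hsub : ∀ (F : ℝ → ℝ) {p : ℝ}, 0 < p → ∫ t, p * F (s - t * p) = ∫ r, F r := by
    intro F p hp
    have h1 := Measure.integral_comp_mul_right (fun x => F (s - x)) p
    rw [integral_const_mul, h1, integral_sub_left_eq_self F volume s, abs_of_pos (inv_pos.mpr hp),
      smul_eq_mul, mul_inv_cancel_left₀ hp.ne']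
  obtain ⟨h1, h2⟩ := (integrable_prod_iff hI.aestronglyMeasurable).mp hI
  have hint : Integrable G (volume.prod (volume.restrict (Ioc (-Real.pi) Real.pi))) := by
    rw [integrable_prod_iff' hG.aestronglyMeasurable]
    refine ⟨?_, h2.congr ?_⟩
    · filter_upwards [h1, hchord] with θ hθ hp
      have h3 : Integrable fun t => G (s - t * chord θ, θ) := by
        have := hθ.const_mul (chord θ)⁻¹
        simpa only [inv_mul_cancel_left₀ hp.ne'] using this
      have h4 : Integrable fun x => G (s - x, θ) :=
        (integrable_comp_mul_right_iff (fun x => G (s - x, θ)) hp.ne').mp h3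
      exact (integrable_comp_sub_left (fun x => G (x, θ)) s).mp h4
    · filter_upwards [hchord] with θ hp
      rw [← hsub (fun r => ‖G (r, θ)‖) hp]
      refine integral_congr_ae (Eventually.of_forall fun t => ?_)
      simp only [norm_mul, Real.norm_of_nonneg hp.le]
  refine ⟨hint, ?_⟩
  rw [integral_prod_symm _ hint, circleLine, integral_prod _ hI]
  refine integral_congr_ae ?_
  filter_upwards [hchord] with θ hp
  exact (hsub (fun r => G (r, θ)) hp).symm

theorem continuous_surfaceMap {φ : ℝ → ℝ} (hφ : Continuous φ) :
    Continuous fun q : ℝ × ℝ => surfaceMap φ q.1 q.2 := by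
  refine (PiLp.continuous_toLp 2 _).comp (continuous_pi fun i => ?_)
  fin_cases i
  · change Continuous fun q : ℝ × ℝ => φ q.1 * Real.cos q.2
    fun_prop
  · change Continuous fun q : ℝ × ℝ => φ q.1 * Real.sin q.2
    fun_prop
  · exact continuous_fst

theorem measurable_fieldIntegrand (φ : ℝ → ℝ) (s : ℝ) : Measurable (fieldIntegrand φ s) := by
  unfold fieldIntegrand
  fun_prop

theorem surfaceMeasure_eq (φ : ℝ → ℝ) : surfaceMeasure φ =
    ((volume.prod (volume.restrict (Ioc (-Real.pi) Real.pi))).withDensity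
      fun q : ℝ × ℝ => ENNReal.ofReal (areaElement φ q.1 q.2)).map
        fun q => surfaceMap φ q.1 q.2 := by
  rw [surfaceMeasure, Measure.volume_eq_prod, ← Measure.prod_restrict, Measure.restrict_univ]

/-- The surface integral converges absolutely, and `𝓗 = ∫∫ ℳ / p_σ + ½ ∫∫ ℳ̄`. -/
theorem integrable_fieldIntegrand_and_calH_eq (hα₀ : 0 < α) (hα₁ : α < 1) {δ : ℝ} (hδ : 0 < δ)
    {φ : HolderSpace 2 α} (hφ : φ ∈ aboveSet α δ) (s : ℝ) :
    Integrable (fieldIntegrand φ s) (surfaceMeasure φ) ∧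
      calH φ s = singularFunctional hα₀ hα₁ s (singularKernel hα₁.le φ) +
          1 / 2 * regularIntegral hα₀ (regularKernel hα₁.le φ) (s, ()) := by
  have hC : ContDiff ℝ 1 φ := φ.2.1.of_le (by norm_num)
  have hpos : ∀ x, 0 < φ x := fun x => hδ.trans (lt_apply_of_mem_aboveSet hφ x)
  have hmap := continuous_surfaceMap hC.continuous
  have hfield := measurable_fieldIntegrand φ s
  have harea : ∀ q : ℝ × ℝ, areaElement φ q.1 q.2 = |φ q.1| * √(1 + deriv φ q.1 ^ 2) := fun q =>
    areaElement_eq (hC.differentiable one_ne_zero) _ _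
  have hmarea : Measurable fun q : ℝ × ℝ => areaElement φ q.1 q.2 := by
    simp only [harea]
    have h1 := hC.continuous
    have h2 := hC.continuous_deriv le_rfl
    exact Continuous.measurable (by fun_prop)
  have hW : 0 < √(1 + deriv φ s ^ 2) := Real.sqrt_pos.mpr (by positivity)
  set G : ℝ × ℝ → ℝ := fun q => -√(1 + deriv φ s ^ 2) *
    (areaElement φ q.1 q.2 * fieldIntegrand φ s (surfaceMap φ q.1 q.2)) with hGdef
  have hG : Measurable G := measurable_const.mul (hmarea.mul (hfield.comp hmap.measurable))
  have hsing := integrable_singularIntegrand hα₀ hα₁ (singularKernel hα₁.le φ) s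
  have hreg := integrable_regularIntegrand (regularKernel hα₁.le φ) s
  have hae : (fun q => singularIntegrand (singularKernel hα₁.le φ) s q +
      1 / 2 * (decay q.2 * regularKernel hα₁.le φ (kernelPoint s q))) =ᵐ[circleLine]
      fun q => chord q.1 * G (s - q.2 * chord q.1, q.1) := by
    refine ae_circleLine fun θ t hθ h0 _ => ?_
    have h1 := kernel_decomposition hC hpos s t (chord_pos hθ h0)
    rw [kernelM_eq hα₁.le hδ hφ, kernelMbar_eq hα₁.le hδ hφ] at h1
    refine Eq.trans ?_ h1.symm
    simp only [singularIntegrand, singularKernel_apply_zero, sub_zero, singularWeight, kernelPoint]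
    ring
  obtain ⟨hGi, hGe⟩ := integral_comp_line hG s ((hsing.add (hreg.const_mul (1 / 2))).congr hae)
  rw [← integral_congr_ae hae, integral_add hsing (hreg.const_mul (1 / 2)),
    integral_const_mul (1 / 2 : ℝ)] at hGe
  have htoReal : ∀ q : ℝ × ℝ, (ENNReal.ofReal (areaElement φ q.1 q.2)).toReal =
      areaElement φ q.1 q.2 := fun q => ENNReal.toReal_ofReal (Real.sqrt_nonneg _)
  have hlt : ∀ᵐ q ∂((volume : Measure ℝ).prod (volume.restrict (Ioc (-Real.pi) Real.pi))),
      ENNReal.ofReal (areaElement φ q.1 q.2) < ⊤ :=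
    Eventually.of_forall fun _ => ENNReal.ofReal_lt_top
  refine ⟨?_, ?_⟩
  · rw [surfaceMeasure_eq, integrable_map_measure hfield.aestronglyMeasurable
      hmap.measurable.aemeasurable,
      integrable_withDensity_iff_integrable_smul' hmarea.ennreal_ofReal hlt]
    have := hGi.const_mul (-√(1 + deriv φ s ^ 2))⁻¹
    refine this.congr (Eventually.of_forall fun q => ?_)
    simp only [hGdef, htoReal, smul_eq_mul, Function.comp_apply]
    rw [inv_mul_cancel_left₀ (neg_ne_zero.mpr hW.ne')]
  · rw [calH, opH, surfaceMeasure_eq, integral_map hmap.measurable.aemeasurable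
      hfield.aestronglyMeasurable,
      integral_withDensity_eq_integral_toReal_smul hmarea.ennreal_ofReal hlt,
      ← integral_const_mul]
    simp only [htoReal, smul_eq_mul]
    exact hGe

end

section

variable {α : ℝ≥0}

/-! ### Smoothness of the operator and of the kernels -/

/-- Pointwise smoothness of the kernels, on the preimage of `inf φ > δ` under a bounded linear
map. -/
theorem contDiffOn_kernels (hα₁ : α < 1) {δ : ℝ} (hδ : 0 < δ) {W : Type*} [NormedAddCommGroup W]
    [NormedSpace ℝ W] (ι : W →L[ℝ] HolderSpace 2 α) (s t p : ℝ) :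
    ContDiffOn ℝ ∞ (fun ψ : W => kernelM (ι ψ) s t p) (ι ⁻¹' aboveSet α δ) ∧
      ContDiffOn ℝ ∞ (fun ψ : W => kernelMbar (ι ψ) s t p) (ι ⁻¹' aboveSet α δ) := by
  have hι : ContDiffOn ℝ ∞ ι (ι ⁻¹' aboveSet α δ) := ι.contDiff.contDiffOn
  have hm := (contDiffOn_singularKernel hα₁.le hδ).comp hι fun _ h => h
  have hb := (contDiffOn_regularKernel hα₁.le hδ).comp hι fun _ h => h
  exact ⟨(((t * decay t) • HolderFamily.eval ((s, t * p), |t|)).contDiff.comp_contDiffOn hm).congr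
      fun ψ hψ => kernelM_eq hα₁.le hδ hψ s t p,
    ((decay t • HolderFamily.eval ((s, t * p), |t|)).contDiff.comp_contDiffOn hb).congr
      fun ψ hψ => kernelMbar_eq hα₁.le hδ hψ s t p⟩

end

end ExceptionalDomain

open ExceptionalDomain in
theorem mainTheorem3 (α : ℝ≥0) (hα₀ : 0 < α) (hα₁ : α < 1) (δ : ℝ) (hδ : 0 < δ) :
    ∃ T : HolderSpace 2 α → HolderSpace 1 α,
      -- `T` is the operator `𝓗`, and the surface integral in its definition converges absolutely
      (∀ φ ∈ aboveSet α δ, ∀ s : ℝ,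
        Integrable (fieldIntegrand φ s) (surfaceMeasure φ) ∧ T φ s = calH φ s) ∧
      -- smoothness and derivatives on the open set `𝒪_δ` of the space `C^{2,α}_{p,e}(ℝ)`
      IsOpen (aboveSetEvenPeriodic α δ) ∧
      ContDiffOn ℝ ∞ (fun φ : evenPeriodic 2 α => T φ) (aboveSetEvenPeriodic α δ) ∧
      (∀ s t p : ℝ,
        ContDiffOn ℝ ∞ (fun ψ : evenPeriodic 2 α => kernelM (ψ : HolderSpace 2 α) s t p)
          (aboveSetEvenPeriodic α δ) ∧
        ContDiffOn ℝ ∞ (fun ψ : evenPeriodic 2 α => kernelMbar (ψ : HolderSpace 2 α) s t p)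
          (aboveSetEvenPeriodic α δ)) ∧
      (∀ φ ∈ aboveSetEvenPeriodic α δ, ∀ (k : ℕ) (v : Fin k → evenPeriodic 2 α) (s : ℝ),
        CircleLineIntegrable (fun θ t => 1 / chord θ * iteratedFDeriv ℝ k
          (fun ψ : evenPeriodic 2 α => kernelM (ψ : HolderSpace 2 α) s t (chord θ)) φ v) ∧
        CircleLineIntegrable (fun θ t => iteratedFDeriv ℝ k
          (fun ψ : evenPeriodic 2 α => kernelMbar (ψ : HolderSpace 2 α) s t (chord θ)) φ v) ∧
        iteratedFDeriv ℝ k (fun ψ : evenPeriodic 2 α => T ψ) φ v s =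
          circleLineIntegral (fun θ t => 1 / chord θ * iteratedFDeriv ℝ k
            (fun ψ : evenPeriodic 2 α => kernelM (ψ : HolderSpace 2 α) s t (chord θ)) φ v) +
          1 / 2 * circleLineIntegral (fun θ t => iteratedFDeriv ℝ k
            (fun ψ : evenPeriodic 2 α => kernelMbar (ψ : HolderSpace 2 α) s t (chord θ)) φ v)) ∧
      -- the same on the open set `inf φ > δ` of `C^{2,α}(ℝ)`, for all directions in `C^{2,α}(ℝ)`
      IsOpen (aboveSet α δ) ∧
      ContDiffOn ℝ ∞ T (aboveSet α δ) ∧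
      (∀ s t p : ℝ,
        ContDiffOn ℝ ∞ (fun ψ : HolderSpace 2 α => kernelM ψ s t p) (aboveSet α δ) ∧
        ContDiffOn ℝ ∞ (fun ψ : HolderSpace 2 α => kernelMbar ψ s t p) (aboveSet α δ)) ∧
      (∀ φ ∈ aboveSet α δ, ∀ (k : ℕ) (v : Fin k → HolderSpace 2 α) (s : ℝ),
        CircleLineIntegrable (fun θ t => 1 / chord θ * iteratedFDeriv ℝ k
          (fun ψ : HolderSpace 2 α => kernelM ψ s t (chord θ)) φ v) ∧
        CircleLineIntegrable (fun θ t => iteratedFDeriv ℝ k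
          (fun ψ : HolderSpace 2 α => kernelMbar ψ s t (chord θ)) φ v) ∧
        iteratedFDeriv ℝ k T φ v s =
          circleLineIntegral (fun θ t => 1 / chord θ * iteratedFDeriv ℝ k
            (fun ψ : HolderSpace 2 α => kernelM ψ s t (chord θ)) φ v) +
          1 / 2 * circleLineIntegral (fun θ t => iteratedFDeriv ℝ k
            (fun ψ : HolderSpace 2 α => kernelMbar ψ s t (chord θ)) φ v)) := by
  obtain ⟨T, hT, hTf⟩ := exists_smooth_operator hα₀ hα₁ hδ
  set ι : evenPeriodic 2 α →L[ℝ] HolderSpace 2 α := (evenPeriodic 2 α).subtypeL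
  refine ⟨T, fun φ hφ s => ?_, (isOpen_aboveSet δ).preimage ι.continuous,
    hT.comp ι.contDiff.contDiffOn fun _ h => h, contDiffOn_kernels hα₁ hδ ι,
    fun φ hφ k v s => derivative_formula hα₀ hα₁ hδ hT hTf ι hφ k v s,
    isOpen_aboveSet δ, hT,
    contDiffOn_kernels hα₁ hδ (ContinuousLinearMap.id ℝ _), fun φ hφ k v s =>
      derivative_formula hα₀ hα₁ hδ hT hTf (ContinuousLinearMap.id ℝ _) hφ k v s⟩
  obtain ⟨h1, h2⟩ := integrable_fieldIntegrand_and_calH_eq hα₀ hα₁ hδ hφ s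
  exact ⟨h1, (hTf φ hφ s).trans h2.symm⟩
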